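/- Let $\mathcal E$ be a category with finite limits and terminal object $1$. *Polynomials.* A polynomial $p$ in $\mathcal E$ is a morphism $p_*\to P$ (from directions to positions) which is exponentiable, i.e. the pullback functor $\mathcal E/P\to\mathcal E/p_*$ has a right adjoint $\Pi_p$. Its polynomial functor is the composite $\mathbf P(p):\mathcal E\xrightarrow{-\times p_*}\mathcal E/p_*\xrightarrow{\Pi_p}\mathcal E/P\to\mathcal E$, the last functor forgetting the map to $P$. A morphism $\varphi:p\to q$ consists of $\varphi_1:P\to Q$ and a morphism $P\times_Q q_*\to p_*$ over $P$; it induces a natural transformation $\mathbf P(\varphi):\mathbf P(p)\to\mathbf P(q)$ by applying $\varphi_1$ to positions and precomposing with the map on directions. These form a category $\mathbf{Poly}_{\mathcal E}$. It is monoidal under the composition product $\triangleleft$ with unit $y=(1\to1)$: $p\triangleleft q$ has object of positions $\mathbf P(p)(Q)$ and object of directions $(\mathbf P(p)(Q)\times_P p_*)\times_Q q_*$, formed with the evaluation map $\mathbf P(p)(Q)\times_P p_*\to Q$, and there are canonical natural isomorphisms $\mathbf P(p\triangleleft q)\cong\mathbf P(p)\circ\mathbf P(q)$ and $\mathbf P(y)\cong\mathrm{id}_{\mathcal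 E}$. *Comonoids, coalgebras, bicomodules.* A comonoid in $\mathbf{Poly}_{\mathcal E}$ is a comonoid in $(\mathbf{Poly}_{\mathcal E},y,\triangleleft)$; via the isomorphisms above a comonoid $c$ makes $\mathbf P(c)$ a comonad on $\mathcal E$. The category $c\text{-}\mathbf{coalg}$ has as objects the coalgebras of this comonad, that is, objects $S$ of $\mathcal E$ with a counital and coassociative morphism $S\to\mathbf P(c)(S)$, and as morphisms the morphisms of $\mathcal E$ commuting with the structure maps. For comonoids $c,d$, a $(c,d)$-bicomodule is a polynomial $m$ with a counital, coassociative left coaction $\kappa:m\to c\triangleleft m$ and a counital, coassociative right coaction $\chi:m\to m\triangleleft d$ such that, up to the associator, $(\mathrm{id}_c\triangleleft\chi)\circ\kappa=(\kappa\triangleleft\mathrm{id}_d)\circ\chi$. **Theorem.** Let $c,d$ be comonoids in $\mathbf{Poly}_{\mathcal E}$ and let $(m,\kappa,\chi)$ be a $(c,d)$-bicomodule. Then there are a functor $F:d\text{-}\mathbf{coalg}\to c\text{-}\mathbf{coalg}$ and morphisms $\iota_S:F(S)\to\mathbf P(m)(S)$ in $\mathcal E$, natural in the $d$-coalgebra $(S,\kappa':S\to\mathbf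 P(d)(S))$, such that: 1. for every $d$-coalgebra $(S,\kappa')$, $\iota_S$ is an equalizer in $\mathcal E$ of the two morphisms $\mathbf P(m)(S)\rightrightarrows\mathbf P(m)(\mathbf P(d)(S))$ given by $\mathbf P(m)(S)\xrightarrow{\mathbf P(\chi)_S}\mathbf P(m\triangleleft d)(S)\cong\mathbf P(m)(\mathbf P(d)(S))$ and by $\mathbf P(m)(\kappa')$; 2. the coalgebra structure on $F(S)$ is induced by $\kappa$: the composite $F(S)\to\mathbf P(c)(F(S))\xrightarrow{\mathbf P(c)(\iota_S)}\mathbf P(c)(\mathbf P(m)(S))$ of the structure map of $F(S)$ with $\mathbf P(c)(\iota_S)$ equals the composite $F(S)\xrightarrow{\iota_S}\mathbf P(m)(S)\xrightarrow{\mathbf P(\kappa)_S}\mathbf P(c\triangleleft m)(S)\cong\mathbf P(c)(\mathbf P(m)(S))$; 3. $F$ preserves connected limits: for every (nonempty) connected category $J$, $F$ preserves all limits of shape $J$ that exist in $d\text{-}\mathbf{coalg}$. -/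

import Mathlib

open CategoryTheory CategoryTheory.Limits

universe w' w v u

noncomputable section

namespace CategoryTheory

attribute [local simp] pullback.lift_fst pullback.lift_fst_assoc pullback.lift_snd
  pullback.lift_snd_assoc

variable {E : Type u} [Category.{v} E]

/-- The pullback of an exponentiable morphism is exponentiable. -/
theorem isLeftAdjoint_pullback_fst [HasPullbacks E] {A A' B : E} (g : A' ⟶ A) (f : B ⟶ A)
    [(Over.pullback f).IsLeftAdjoint] :
    (Over.pullback (pullback.fst g f)).IsLeftAdjoint := by
  let G : Over A' ⥤ Over (pullback g f) :=
    (Over.mk g).iteratedSliceBackward ⋙ Over.post (X := Over.mk g) (Over.pullback f) ⋙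
      ((Over.pullback f).obj (Over.mk g)).iteratedSliceForward
  have : (Over.mk g).iteratedSliceBackward.IsLeftAdjoint :=
    inferInstanceAs ((Over.mk g).iteratedSliceEquiv.inverse.IsLeftAdjoint)
  have : ((Over.pullback f).obj (Over.mk g)).iteratedSliceForward.IsLeftAdjoint :=
    inferInstanceAs (((Over.pullback f).obj (Over.mk g)).iteratedSliceEquiv.functor.IsLeftAdjoint)
  have : G.IsLeftAdjoint := by infer_instance
  have h₁ {D : E} (h : D ⟶ A') : (pullbackRightPullbackFstIso g f h).inv ≫
      pullback.snd h (pullback.fst g f) =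
      pullback.lift (pullback.fst (h ≫ g) f ≫ h) (pullback.snd (h ≫ g) f)
        (by simp [pullback.condition]) := by
    rw [Iso.inv_comp_eq]
    apply pullback.hom_ext <;> simp [pullback.condition]
  have h₂ {X Y : E} (k : X ⟶ Y) (x : X ⟶ A') (y : Y ⟶ A') (w : k ≫ y = x) :
      pullback.lift (f := y ≫ g) (g := f) (pullback.fst (x ≫ g) f ≫ k) (pullback.snd (x ≫ g) f)
        (by simp [← pullback.condition, reassoc_of% w]) ≫
          (pullbackRightPullbackFstIso g f y).inv =
      (pullbackRightPullbackFstIso g f x).inv ≫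
        pullback.lift (pullback.fst x (pullback.fst g f) ≫ k) (pullback.snd x (pullback.fst g f))
          (by simp [← pullback.condition, w]) := by
    rw [Iso.eq_inv_comp, ← Category.assoc, Iso.comp_inv_eq]
    apply pullback.hom_ext <;> simp
  exact Functor.isLeftAdjoint_of_iso (F := G) (NatIso.ofComponents (fun D => Over.isoMk
    (pullbackRightPullbackFstIso g f D.hom).symm (h₁ D.hom))
      (fun {X Y} k => Over.OverMorphism.ext (h₂ k.left X.hom Y.hom (Over.w k))))

theorem isLeftAdjoint_pullback_comp [HasPullbacks E] {A B C : E} (f : A ⟶ B) (g : B ⟶ C)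
    [(Over.pullback f).IsLeftAdjoint] [(Over.pullback g).IsLeftAdjoint] :
    (Over.pullback (f ≫ g)).IsLeftAdjoint :=
  Functor.isLeftAdjoint_of_iso (Over.pullbackComp f g).symm

theorem isLeftAdjoint_pullback_id [HasPullbacks E] (A : E) :
    (Over.pullback (𝟙 A)).IsLeftAdjoint :=
  Functor.isLeftAdjoint_of_iso (Over.pullbackId (X := A)).symm

/-- A polynomial in `E`: an exponentiable morphism `proj : dir ⟶ pos`, that is, a morphism such
that the pullback functor `Over pos ⥤ Over dir` has a right adjoint. -/
structure PolyIn (E : Type u) [Category.{v} E] [HasPullbacks E] where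
  /-- the object of positions (the base) -/
  pos : E
  /-- the object of directions (the total space) -/
  dir : E
  /-- the underlying morphism -/
  proj : dir ⟶ pos
  exponentiable : (Over.pullback proj).IsLeftAdjoint

namespace PolyIn

attribute [instance] PolyIn.exponentiable

section Category

variable [HasPullbacks E]

/-- A morphism of polynomials: a map on positions, and a map
`p.pos ×_{q.pos} q.dir ⟶ p.dir` over `p.pos`.  (With the chosen pullbacks, each isomorphism class
of representing diagrams has exactly one representative of this form.) -/
@[ext]
structure Hom (p q : PolyIn E) where
  onPos : p.pos ⟶ q.pos
  onDir : pullback onPos q.proj ⟶ p.dir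
  onDir_proj : onDir ≫ p.proj = pullback.fst onPos q.proj

attribute [simp] Hom.onDir_proj

/-- The action of a morphism of polynomials on generalized elements: it sends a position `b` of `p`
and a direction `y` of `q` at the image of `b` to a direction of `p` at `b`. -/
def Hom.dirAt {p q : PolyIn E} (φ : Hom p q) {B : E} (b : B ⟶ p.pos) (y : B ⟶ q.dir)
    (w : b ≫ φ.onPos = y ≫ q.proj) : B ⟶ p.dir :=
  pullback.lift b y w ≫ φ.onDir

@[simp]
theorem Hom.dirAt_proj {p q : PolyIn E} (φ : Hom p q) {B : E} (b : B ⟶ p.pos) (y : B ⟶ q.dir)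
    (w : b ≫ φ.onPos = y ≫ q.proj) : φ.dirAt b y w ≫ p.proj = b := by
  simp [dirAt]

@[simp]
theorem Hom.comp_dirAt {p q : PolyIn E} (φ : Hom p q) {B C : E} (u : C ⟶ B) (b : B ⟶ p.pos)
    (y : B ⟶ q.dir) (w : b ≫ φ.onPos = y ≫ q.proj) :
    u ≫ φ.dirAt b y w = φ.dirAt (u ≫ b) (u ≫ y) (by simp [w]) := by
  rw [dirAt, dirAt, ← Category.assoc]
  congr 1
  apply pullback.hom_ext <;> simp

theorem Hom.comp_dirAt_eq {p q : PolyIn E} (φ : Hom p q) {B C : E} (u : C ⟶ B) (b : B ⟶ p.pos)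
    (y : B ⟶ q.dir) (w : b ≫ φ.onPos = y ≫ q.proj) {b' : C ⟶ p.pos} {y' : C ⟶ q.dir}
    (hb : u ≫ b = b') (hy : u ≫ y = y') :
    u ≫ φ.dirAt b y w = φ.dirAt b' y' (by simp [← hb, ← hy, w]) := by
  subst hb hy
  exact φ.comp_dirAt u b y w

theorem Hom.dirAt_congr {p q : PolyIn E} (φ : Hom p q) {B : E} {b b' : B ⟶ p.pos}
    {y y' : B ⟶ q.dir} (hb : b = b') (hy : y = y') (w : b ≫ φ.onPos = y ≫ q.proj) :
    φ.dirAt b y w = φ.dirAt b' y' (by rw [← hb, ← hy, w]) := by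
  subst hb hy
  rfl

theorem Hom.ext_dirAt {p q : PolyIn E} {φ ψ : Hom p q} (h : φ.onPos = ψ.onPos)
    (h' : ∀ {B : E} (b : B ⟶ p.pos) (y : B ⟶ q.dir) (w : b ≫ φ.onPos = y ≫ q.proj)
      (w' : b ≫ ψ.onPos = y ≫ q.proj), φ.dirAt b y w = ψ.dirAt b y w') : φ = ψ := by
  obtain ⟨f, g, hg⟩ := φ
  obtain ⟨f', g', hg'⟩ := ψ
  obtain rfl : f = f' := h
  have := h' (pullback.fst f q.proj) (pullback.snd f q.proj) pullback.condition pullback.condition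
  simpa [dirAt] using this

/-- The identity morphism. -/
def Hom.id (p : PolyIn E) : Hom p p where
  onPos := 𝟙 p.pos
  onDir := pullback.snd (𝟙 p.pos) p.proj
  onDir_proj := by simp [← pullback.condition]

/-- Composition of morphisms of polynomials: on directions, first `ψ`, then `φ`. -/
def Hom.comp {p q r : PolyIn E} (φ : Hom p q) (ψ : Hom q r) : Hom p r where
  onPos := φ.onPos ≫ ψ.onPos
  onDir := φ.dirAt (pullback.fst (φ.onPos ≫ ψ.onPos) r.proj)
    (ψ.dirAt (pullback.fst (φ.onPos ≫ ψ.onPos) r.proj ≫ φ.onPos)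
      (pullback.snd (φ.onPos ≫ ψ.onPos) r.proj) (by simp [pullback.condition])) (by simp)
  onDir_proj := by simp

theorem Hom.dirAt_id (p : PolyIn E) {B : E} (b : B ⟶ p.pos) (y : B ⟶ p.dir)
    (w : b ≫ (Hom.id p).onPos = y ≫ p.proj) : (Hom.id p).dirAt b y w = y :=
  pullback.lift_snd _ _ _

theorem Hom.dirAt_comp {p q r : PolyIn E} (φ : Hom p q) (ψ : Hom q r) {B : E} (b : B ⟶ p.pos)
    (y : B ⟶ r.dir) (w : b ≫ (φ.comp ψ).onPos = y ≫ r.proj) :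
    (φ.comp ψ).dirAt b y w = φ.dirAt b (ψ.dirAt (b ≫ φ.onPos) y
      ((Category.assoc _ _ _).trans w)) (by simp) :=
  φ.comp_dirAt_eq _ _ _ _ (pullback.lift_fst _ _ _)
    (ψ.comp_dirAt_eq _ _ _ _ (pullback.lift_fst_assoc _ _ _ _) (pullback.lift_snd _ _ _))

instance : Category (PolyIn E) where
  Hom := Hom
  id := Hom.id
  comp := Hom.comp
  id_comp φ := Hom.ext_dirAt (Category.id_comp _) (fun b y w w' => by
    rw [Hom.dirAt_comp, Hom.dirAt_id]
    exact φ.dirAt_congr (Category.comp_id _) rfl _)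
  comp_id φ := Hom.ext_dirAt (Category.comp_id _) (fun b y w w' => by
    rw [Hom.dirAt_comp]
    exact φ.dirAt_congr rfl (Hom.dirAt_id _ _ _ _) _)
  assoc φ ψ χ := Hom.ext_dirAt (Category.assoc _ _ _) (fun b y w w' => by
    simp only [Hom.dirAt_comp]
    exact φ.dirAt_congr rfl
      (ψ.dirAt_congr rfl (χ.dirAt_congr (Category.assoc _ _ _).symm rfl _) _) _)

@[simp]
theorem id_onPos (p : PolyIn E) : Hom.onPos (𝟙 p) = 𝟙 p.pos := rfl

@[simp]
theorem comp_onPos {p q r : PolyIn E} (φ : p ⟶ q) (ψ : q ⟶ r) :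
    Hom.onPos (φ ≫ ψ) = φ.onPos ≫ ψ.onPos := rfl

@[simp]
theorem id_dirAt (p : PolyIn E) {B : E} (b : B ⟶ p.pos) (y : B ⟶ p.dir)
    (w : b ≫ Hom.onPos (𝟙 p) = y ≫ p.proj) : Hom.dirAt (𝟙 p) b y w = y :=
  Hom.dirAt_id p b y w

@[simp]
theorem comp_dirAt {p q r : PolyIn E} (φ : p ⟶ q) (ψ : q ⟶ r) {B : E} (b : B ⟶ p.pos)
    (y : B ⟶ r.dir) (w : b ≫ Hom.onPos (φ ≫ ψ) = y ≫ r.proj) :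
    Hom.dirAt (φ ≫ ψ) b y w = φ.dirAt b (ψ.dirAt (b ≫ φ.onPos) y
      ((Category.assoc _ _ _).trans w)) (by simp) :=
  Hom.dirAt_comp φ ψ b y w

end Category

variable [HasFiniteLimits E]

/-! ### Polynomial functors -/

/-- The polynomial functor `E ≌ Over 1 ⥤ Over p.dir ⥤ Over p.pos ⥤ Over 1 ≌ E` of `p`: take the
product with `p.dir`, apply the right adjoint of pulling back along `p.proj`, and forget the map
to `p.pos`. -/
def eval (p : PolyIn E) : E ⥤ E :=
  Over.star p.dir ⋙ (Over.pullback p.proj).rightAdjoint ⋙ Over.forget p.pos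

/-- The adjunction which yields the universal property of the polynomial functor. -/
def evalAdj (p : PolyIn E) : Over.pullback p.proj ⋙ Over.forget p.dir ⊣
    Over.star p.dir ⋙ (Over.pullback p.proj).rightAdjoint :=
  (Adjunction.ofIsLeftAdjoint (Over.pullback p.proj)).comp (Over.forgetAdjStar p.dir)

/-- The projection of `p.eval.obj A` to the positions. -/
def evalFst (p : PolyIn E) (A : E) : p.eval.obj A ⟶ p.pos :=
  ((Over.star p.dir ⋙ (Over.pullback p.proj).rightAdjoint).obj A).hom

/-- The universal evaluation map `p.eval.obj A ×_{p.pos} p.dir ⟶ A`. -/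
def ev (p : PolyIn E) (A : E) : pullback (p.evalFst A) p.proj ⟶ A :=
  p.evalAdj.counit.app A

/-- The universal property of `p.eval.obj A`: a map to it is given by a map `f` to `p.pos` together
with a map `B ×_{p.pos} p.dir ⟶ A`. -/
def evalMk (p : PolyIn E) {A B : E} (f : B ⟶ p.pos) (g : pullback f p.proj ⟶ A) :
    B ⟶ p.eval.obj A :=
  (p.evalAdj.homEquiv (Over.mk f) A g).left

/-- Evaluation of a generalized element of `p.eval.obj A` at a generalized direction. -/
def evalAt (p : PolyIn E) {A B : E} (z : B ⟶ p.eval.obj A) (x : B ⟶ p.dir)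
    (w : z ≫ p.evalFst A = x ≫ p.proj) : B ⟶ A :=
  pullback.lift z x w ≫ p.ev A

@[simp]
theorem evalMk_fst (p : PolyIn E) {A B : E} (f : B ⟶ p.pos) (g : pullback f p.proj ⟶ A) :
    p.evalMk f g ≫ p.evalFst A = f :=
  Over.w (p.evalAdj.homEquiv (Over.mk f) A g)

@[simp]
theorem evalMk_fst_assoc (p : PolyIn E) {A B Z : E} (f : B ⟶ p.pos)
    (g : pullback f p.proj ⟶ A) (k : p.pos ⟶ Z) :
    p.evalMk f g ≫ p.evalFst A ≫ k = f ≫ k := by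
  rw [← Category.assoc, evalMk_fst]

@[simp]
theorem eval_map_fst (p : PolyIn E) {A B : E} (h : A ⟶ B) :
    p.eval.map h ≫ p.evalFst B = p.evalFst A :=
  Over.w ((Over.star p.dir ⋙ (Over.pullback p.proj).rightAdjoint).map h)

@[simp]
theorem eval_map_fst_assoc (p : PolyIn E) {A B Z : E} (h : A ⟶ B) (k : p.pos ⟶ Z) :
    p.eval.map h ≫ p.evalFst B ≫ k = p.evalFst A ≫ k := by
  rw [← Category.assoc, eval_map_fst]

@[simp]
theorem comp_evalAt (p : PolyIn E) {A B C : E} (u : C ⟶ B) (z : B ⟶ p.eval.obj A) (x : B ⟶ p.dir)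
    (w : z ≫ p.evalFst A = x ≫ p.proj) :
    u ≫ p.evalAt z x w = p.evalAt (u ≫ z) (u ≫ x) (by simp [w]) := by
  rw [evalAt, evalAt, ← Category.assoc]
  congr 1
  apply pullback.hom_ext <;> simp

theorem evalAt_comp_eval_map (p : PolyIn E) {A A' B : E} (z : B ⟶ p.eval.obj A) (x : B ⟶ p.dir)
    (h : A ⟶ A') (w : (z ≫ p.eval.map h) ≫ p.evalFst A' = x ≫ p.proj) :
    p.evalAt (z ≫ p.eval.map h) x w = p.evalAt z x (by simpa using w) ≫ h := by
  have := p.evalAdj.counit.naturality h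
  have e : pullback.lift (pullback.fst (p.evalFst A) p.proj ≫ p.eval.map h)
      (pullback.snd (p.evalFst A) p.proj) (by simp [pullback.condition]) ≫ p.ev A' =
      p.ev A ≫ h := this
  rw [evalAt, evalAt, Category.assoc, ← e, ← Category.assoc]
  congr 1
  apply pullback.hom_ext <;> simp

theorem evalAt_evalMk (p : PolyIn E) {A B C : E} (f : B ⟶ p.pos) (g : pullback f p.proj ⟶ A)
    (b : C ⟶ B) (x : C ⟶ p.dir) (w : (b ≫ p.evalMk f g) ≫ p.evalFst A = x ≫ p.proj) :
    p.evalAt (b ≫ p.evalMk f g) x w = pullback.lift b x (by simpa using w) ≫ g := by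
  have : pullback.lift (pullback.fst f p.proj ≫ p.evalMk f g) (pullback.snd f p.proj)
      (by simp [pullback.condition]) ≫ p.ev A = g :=
    (p.evalAdj.homEquiv_counit (X := Over.mk f) (Y := A)
      (g := p.evalAdj.homEquiv (Over.mk f) A g)).symm.trans
        ((p.evalAdj.homEquiv (Over.mk f) A).symm_apply_apply g)
  refine Eq.trans ?_ (congrArg (fun k => pullback.lift b x (by simpa using w) ≫ k) this)
  rw [evalAt, ← Category.assoc]
  congr 1
  apply pullback.hom_ext <;> simp

theorem eval_hom_ext (p : PolyIn E) {A B : E} {z z' : B ⟶ p.eval.obj A}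
    (h : z ≫ p.evalFst A = z' ≫ p.evalFst A)
    (h' : ∀ {C : E} (b : C ⟶ B) (x : C ⟶ p.dir) (w : (b ≫ z) ≫ p.evalFst A = x ≫ p.proj)
      (w' : (b ≫ z') ≫ p.evalFst A = x ≫ p.proj),
      p.evalAt (b ≫ z) x w = p.evalAt (b ≫ z') x w') : z = z' := by
  let U : Over.mk (z ≫ p.evalFst A) ⟶
    (Over.star p.dir ⋙ (Over.pullback p.proj).rightAdjoint).obj A := Over.homMk z rfl
  let U' : Over.mk (z ≫ p.evalFst A) ⟶
    (Over.star p.dir ⋙ (Over.pullback p.proj).rightAdjoint).obj A := Over.homMk z' h.symm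
  suffices U = U' from congrArg (fun k => k.left) this
  apply (p.evalAdj.homEquiv _ _).symm.injective
  rw [p.evalAdj.homEquiv_counit, p.evalAdj.homEquiv_counit]
  exact h' (pullback.fst (z ≫ p.evalFst A) p.proj) (pullback.snd (z ≫ p.evalFst A) p.proj)
    (by simp [pullback.condition]) (by simp [← h, pullback.condition])

theorem comp_evalAt_eq (p : PolyIn E) {A B C : E} (u : C ⟶ B) (z : B ⟶ p.eval.obj A)
    (x : B ⟶ p.dir) (w : z ≫ p.evalFst A = x ≫ p.proj) {z' : C ⟶ p.eval.obj A} {x' : C ⟶ p.dir}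
    (hz : u ≫ z = z') (hx : u ≫ x = x') :
    u ≫ p.evalAt z x w = p.evalAt z' x' (by simp [← hz, ← hx, w]) := by
  subst hz hx
  exact p.comp_evalAt u z x w

theorem evalAt_congr (p : PolyIn E) {A B : E} {z z' : B ⟶ p.eval.obj A}
    {x x' : B ⟶ p.dir} (hz : z = z') (hx : x = x') (w : z ≫ p.evalFst A = x ≫ p.proj) :
    p.evalAt z x w = p.evalAt z' x' (by rw [← hz, ← hx, w]) := by
  subst hz hx
  rfl

/-- The natural transformation of polynomial functors induced by a morphism of polynomials, at an
object `A`: it sends an element `z` over the position `b` to the element over `φ b` whose value at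
a direction `y` is the value of `z` at `φ.dirAt b y`. -/
def evalMapApp {p q : PolyIn E} (φ : p ⟶ q) (A : E) : p.eval.obj A ⟶ q.eval.obj A :=
  q.evalMk (p.evalFst A ≫ φ.onPos)
    (p.evalAt (pullback.fst (p.evalFst A ≫ φ.onPos) q.proj)
      (φ.dirAt (pullback.fst (p.evalFst A ≫ φ.onPos) q.proj ≫ p.evalFst A)
        (pullback.snd (p.evalFst A ≫ φ.onPos) q.proj) (by simp [pullback.condition])) (by simp))

@[simp]
theorem evalMapApp_fst {p q : PolyIn E} (φ : p ⟶ q) (A : E) :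
    evalMapApp φ A ≫ q.evalFst A = p.evalFst A ≫ φ.onPos :=
  evalMk_fst _ _ _

@[simp]
theorem evalMapApp_fst_assoc {p q : PolyIn E} (φ : p ⟶ q) (A : E) {Z : E} (k : q.pos ⟶ Z) :
    evalMapApp φ A ≫ q.evalFst A ≫ k = p.evalFst A ≫ φ.onPos ≫ k := by
  rw [← Category.assoc, evalMapApp_fst, Category.assoc]

theorem evalAt_evalMapApp {p q : PolyIn E} (φ : p ⟶ q) {A B : E} (z : B ⟶ p.eval.obj A)
    (y : B ⟶ q.dir) (w : (z ≫ evalMapApp φ A) ≫ q.evalFst A = y ≫ q.proj) :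
    q.evalAt (z ≫ evalMapApp φ A) y w =
      p.evalAt z (φ.dirAt (z ≫ p.evalFst A) y (by simpa using w)) (by simp) := by
  refine (q.evalAt_evalMk _ _ _ _ _).trans ?_
  exact p.comp_evalAt_eq _ _ _ _ (pullback.lift_fst _ _ _) (φ.comp_dirAt_eq _ _ _ _
        (pullback.lift_fst_assoc _ _ _ _) (pullback.lift_snd _ _ _))

/-- The natural transformation of polynomial functors induced by a morphism of polynomials. -/
@[simps app]
def evalMap {p q : PolyIn E} (φ : p ⟶ q) : p.eval ⟶ q.eval where
  app := evalMapApp φ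
  naturality A A' h := by
    refine eval_hom_ext _ (by simp) (fun b x w w' => ?_)
    have e₁ : b ≫ p.eval.map h ≫ evalMapApp φ A' = (b ≫ p.eval.map h) ≫ evalMapApp φ A' :=
      (Category.assoc _ _ _).symm
    have e₂ : b ≫ evalMapApp φ A ≫ q.eval.map h = (b ≫ evalMapApp φ A) ≫ q.eval.map h :=
      (Category.assoc _ _ _).symm
    rw [q.evalAt_congr e₁ rfl, q.evalAt_congr e₂ rfl, evalAt_comp_eval_map, evalAt_evalMapApp,
      evalAt_evalMapApp, evalAt_comp_eval_map]
    congr 1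
    exact p.evalAt_congr rfl (φ.dirAt_congr (by simp) rfl _) _

theorem evalMapApp_naturality {p q : PolyIn E} (φ : p ⟶ q) {A A' : E} (h : A ⟶ A') :
    p.eval.map h ≫ evalMapApp φ A' = evalMapApp φ A ≫ q.eval.map h :=
  (evalMap φ).naturality h

theorem evalMapApp_naturality_assoc {p q : PolyIn E} (φ : p ⟶ q) {A A' : E} (h : A ⟶ A') {Z : E}
    (k : q.eval.obj A' ⟶ Z) :
    p.eval.map h ≫ evalMapApp φ A' ≫ k = evalMapApp φ A ≫ q.eval.map h ≫ k := by
  rw [← Category.assoc, evalMapApp_naturality, Category.assoc]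

theorem evalMap_id (p : PolyIn E) : evalMap (𝟙 p) = 𝟙 p.eval := by
  ext A
  refine eval_hom_ext _ (by simp) (fun b x w w' => ?_)
  refine (evalAt_evalMapApp _ _ _ _).trans ?_
  exact p.evalAt_congr (by simp) (id_dirAt _ _ _ _) _

theorem evalMap_comp {p q r : PolyIn E} (φ : p ⟶ q) (ψ : q ⟶ r) :
    evalMap (φ ≫ ψ) = evalMap φ ≫ evalMap ψ := by
  ext A
  refine eval_hom_ext _ (by simp) (fun b x w w' => ?_)
  have e : b ≫ (evalMap φ ≫ evalMap ψ).app A = (b ≫ evalMapApp φ A) ≫ evalMapApp ψ A :=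
    (Category.assoc _ _ _).symm
  refine (evalAt_evalMapApp _ _ _ _).trans ?_
  rw [r.evalAt_congr e rfl, evalAt_evalMapApp, evalAt_evalMapApp]
  refine p.evalAt_congr rfl ((comp_dirAt _ _ _ _ _).trans
    (φ.dirAt_congr rfl (ψ.dirAt_congr (by simp) rfl _) _)) _

/-- A morphism of polynomials is determined by its natural transformation. -/
theorem evalMap_injective {p q : PolyIn E} {φ ψ : p ⟶ q} (h : evalMap φ = evalMap ψ) : φ = ψ := by
  have hA : evalMapApp φ p.dir = evalMapApp ψ p.dir := congrArg (fun k => k.app p.dir) h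
  have hpos : φ.onPos = ψ.onPos := by
    have := congrArg (fun k => p.evalMk (𝟙 _) (pullback.snd (𝟙 p.pos) p.proj) ≫ k ≫ q.evalFst _) hA
    simpa using this
  refine Hom.ext_dirAt hpos (fun {B} b y w w' => ?_)
  let z : B ⟶ p.eval.obj p.dir := b ≫ p.evalMk (𝟙 _) (pullback.snd (𝟙 p.pos) p.proj)
  have hz : z ≫ p.evalFst _ = b := by simp [z]
  have key (x : B ⟶ p.dir) (hx : z ≫ p.evalFst _ = x ≫ p.proj) : p.evalAt z x hx = x := by
    dsimp only [z]
    rw [evalAt_evalMk]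
    exact pullback.lift_snd _ _ _
  have h₁ := q.evalAt_congr (congrArg (fun k => z ≫ k) hA) (rfl : y = y)
    (by simpa [reassoc_of% hz] using w)
  rw [evalAt_evalMapApp, evalAt_evalMapApp, key, key] at h₁
  exact (φ.dirAt_congr hz.symm rfl _).trans (h₁.trans (ψ.dirAt_congr hz rfl _))

/-! ### The composition product -/

variable (E) in
/-- The identity polynomial: the identity of the terminal object. -/
@[reducible]
def unit : PolyIn E where
  pos := ⊤_ E
  dir := ⊤_ E
  proj := 𝟙 (⊤_ E)
  exponentiable := isLeftAdjoint_pullback_id _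

section

/-- The directions of the composition product. -/
abbrev triDir (p q : PolyIn E) : E := pullback (p.ev q.pos) q.proj

/-- The projection of the composition product. -/
def triProj (p q : PolyIn E) : triDir p q ⟶ p.eval.obj q.pos :=
  pullback.fst (p.ev q.pos) q.proj ≫ pullback.fst (p.evalFst q.pos) p.proj

/-- The composition product of two polynomials. Its positions are `p.eval.obj q.pos`, its
directions `(p.eval.obj q.pos ×_{p.pos} p.dir) ×_{q.pos} q.dir`. -/
@[reducible]
def tri (p q : PolyIn E) : PolyIn E where
  pos := p.eval.obj q.pos
  dir := triDir p q
  proj := triProj p q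
  exponentiable := by
    have h₁ := isLeftAdjoint_pullback_fst (p.ev q.pos) q.proj
    have h₂ := isLeftAdjoint_pullback_fst (p.evalFst q.pos) p.proj
    exact isLeftAdjoint_pullback_comp _ _

variable {p q : PolyIn E}

/-- The `p`-direction underlying a direction of `p.tri q`. -/
def triFst (p q : PolyIn E) : triDir p q ⟶ p.dir :=
  pullback.fst (p.ev q.pos) q.proj ≫ pullback.snd (p.evalFst q.pos) p.proj

/-- The `q`-direction underlying a direction of `p.tri q`. -/
def triSnd (p q : PolyIn E) : triDir p q ⟶ q.dir :=
  pullback.snd (p.ev q.pos) q.proj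

theorem triProj_fst (p q : PolyIn E) :
    triProj p q ≫ p.evalFst q.pos = p.triFst q ≫ p.proj := by
  simp only [triFst, triProj, triDir, pullback.condition, Category.assoc]

theorem triSnd_proj (p q : PolyIn E) :
    p.evalAt (triProj p q) (p.triFst q) (p.triProj_fst q) = p.triSnd q ≫ q.proj := by
  refine Eq.trans ?_ pullback.condition
  rw [evalAt]
  congr 1
  apply pullback.hom_ext <;> simp [triFst, triProj]

/-- A generalized direction of `p.tri q` at `z` is a direction `x` of `p` together with a direction
`y` of `q` at the value of `z` at `x`. -/
def triMk {B : E} (z : B ⟶ p.eval.obj q.pos) (x : B ⟶ p.dir) (y : B ⟶ q.dir)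
    (wx : z ≫ p.evalFst q.pos = x ≫ p.proj) (wy : p.evalAt z x wx = y ≫ q.proj) :
    B ⟶ triDir p q :=
  pullback.lift (pullback.lift z x wx) y wy

section

variable {B : E} (z : B ⟶ p.eval.obj q.pos) (x : B ⟶ p.dir) (y : B ⟶ q.dir)
    (wx : z ≫ p.evalFst q.pos = x ≫ p.proj) (wy : p.evalAt z x wx = y ≫ q.proj)

@[simp]
theorem triMk_proj : triMk z x y wx wy ≫ triProj p q = z :=
  (pullback.lift_fst_assoc _ _ _ _).trans (pullback.lift_fst _ _ _)

@[simp]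
theorem triMk_fst : triMk z x y wx wy ≫ p.triFst q = x :=
  (pullback.lift_fst_assoc _ _ _ _).trans (pullback.lift_snd _ _ _)

@[simp]
theorem triMk_snd : triMk z x y wx wy ≫ p.triSnd q = y :=
  pullback.lift_snd _ _ _

theorem tri_hom_ext {t t' : B ⟶ triDir p q} (h : t ≫ triProj p q = t' ≫ triProj p q)
    (h₁ : t ≫ p.triFst q = t' ≫ p.triFst q) (h₂ : t ≫ p.triSnd q = t' ≫ p.triSnd q) : t = t' := by
  apply pullback.hom_ext
  · apply pullback.hom_ext
    · exact (Category.assoc _ _ _).trans (h.trans (Category.assoc _ _ _).symm)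
    · exact (Category.assoc _ _ _).trans (h₁.trans (Category.assoc _ _ _).symm)
  · exact h₂

theorem triFst_at (t : B ⟶ triDir p q) (w : z = t ≫ triProj p q) :
    z ≫ p.evalFst q.pos = (t ≫ p.triFst q) ≫ p.proj := by
  rw [w, Category.assoc, triProj_fst, Category.assoc]

theorem triSnd_at (t : B ⟶ triDir p q) (w : z = t ≫ triProj p q) :
    p.evalAt z (t ≫ p.triFst q) (triFst_at z t w) = (t ≫ p.triSnd q) ≫ q.proj := by
  subst w
  rw [Category.assoc, ← triSnd_proj, comp_evalAt]

end

theorem triMk_congr {B : E} {z z' : B ⟶ p.eval.obj q.pos} {x x' : B ⟶ p.dir} {y y' : B ⟶ q.dir}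
    (hz : z = z') (hx : x = x') (hy : y = y')
    (wx : z ≫ p.evalFst q.pos = x ≫ p.proj) (wy : p.evalAt z x wx = y ≫ q.proj) :
    triMk z x y wx wy = triMk z' x' y' (by rw [← hz, ← hx, wx])
      (by subst hz hx hy; exact wy) := by
  subst hz hx hy
  rfl

theorem comp_triMk_eq {B C : E} (u : C ⟶ B) {z : B ⟶ p.eval.obj q.pos} {x : B ⟶ p.dir}
    {y : B ⟶ q.dir} (wx : z ≫ p.evalFst q.pos = x ≫ p.proj) (wy : p.evalAt z x wx = y ≫ q.proj)
    {z' : C ⟶ p.eval.obj q.pos} {x' : C ⟶ p.dir} {y' : C ⟶ q.dir}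
    (hz : u ≫ z = z') (hx : u ≫ x = x') (hy : u ≫ y = y') :
    u ≫ triMk z x y wx wy = triMk z' x' y' (by simp [← hz, ← hx, wx])
      (by subst hz hx hy; rw [← comp_evalAt _ _ _ _ wx, wy, Category.assoc]) := by
  subst hz hx hy
  exact tri_hom_ext (by simp) (by simp) (by simp)

end

/-! ### Compatibility of polynomial functors with the unit and with composition -/

/-- The polynomial functor of the identity polynomial is the identity functor. -/
def evalUnit : (unit E).eval ≅ 𝟭 E :=
  NatIso.ofComponents
    (fun A =>
      { hom := (unit E).evalAt (𝟙 _) (terminal.from _) (Subsingleton.elim _ _)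
        inv := (unit E).evalMk (terminal.from A) (pullback.fst (terminal.from A) (unit E).proj)
        hom_inv_id := eval_hom_ext _ (Subsingleton.elim _ _) (fun b x w w' => by
          have e : b ≫ (unit E).evalAt (𝟙 _) (terminal.from _) (Subsingleton.elim _ _) ≫
              (unit E).evalMk (terminal.from A) (pullback.fst (terminal.from A) (unit E).proj) =
              (b ≫ (unit E).evalAt (𝟙 _) (terminal.from _) (Subsingleton.elim _ _)) ≫
              (unit E).evalMk (terminal.from A) (pullback.fst (terminal.from A) (unit E).proj) :=
            (Category.assoc _ _ _).symm
          rw [evalAt_congr _ e rfl, evalAt_evalMk]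
          refine (pullback.lift_fst _ _ _).trans ?_
          exact comp_evalAt_eq _ _ _ _ _ rfl (Subsingleton.elim _ _))
        inv_hom_id := by
          refine (comp_evalAt _ _ _ _ _).trans ((evalAt_congr _ ((Category.comp_id _).trans
            (Category.id_comp _).symm) rfl _).trans ((evalAt_evalMk _ _ _ _ _ _).trans ?_))
          exact pullback.lift_fst _ _ _ })
    (fun {A B} h => by
      refine (comp_evalAt _ _ _ _ _).trans ((evalAt_congr _ ((Category.comp_id _).trans
            (Category.id_comp _).symm) rfl _).trans ((evalAt_comp_eval_map _ _ _ _ _).trans ?_))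
      exact congrArg (fun k => k ≫ h) (evalAt_congr _ rfl (Subsingleton.elim _ _) _))

section

variable (p q : PolyIn E)

theorem evalComp_fst {p q : PolyIn E} {A B : E} (z : B ⟶ p.eval.obj (q.eval.obj A))
    (t : B ⟶ triDir p q) (w : z ≫ p.eval.map (q.evalFst A) = t ≫ triProj p q) :
    z ≫ p.evalFst (q.eval.obj A) = (t ≫ p.triFst q) ≫ p.proj := by
  rw [Category.assoc, ← triProj_fst, ← reassoc_of% w, eval_map_fst]

theorem evalComp_snd {p q : PolyIn E} {A B : E} (z : B ⟶ p.eval.obj (q.eval.obj A))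
    (t : B ⟶ triDir p q) (w : z ≫ p.eval.map (q.evalFst A) = t ≫ triProj p q) :
    p.evalAt z (t ≫ p.triFst q) (evalComp_fst z t w) ≫ q.evalFst A =
      (t ≫ p.triSnd q) ≫ q.proj := by
  rw [← triSnd_at _ t w, evalAt_comp_eval_map]

/-- The comparison map `p.eval.obj (q.eval.obj A) ⟶ (p.tri q).eval.obj A`: the value of `z` at the
direction `(x, y)` is the value at `y` of the value at `x` of `z`. -/
def evalCompHom (A : E) : p.eval.obj (q.eval.obj A) ⟶ (p.tri q).eval.obj A :=
  (p.tri q).evalMk (p.eval.map (q.evalFst A))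
    (q.evalAt
      (p.evalAt (pullback.fst (p.eval.map (q.evalFst A)) (triProj p q))
        (pullback.snd (p.eval.map (q.evalFst A)) (triProj p q) ≫ p.triFst q)
        (evalComp_fst _ _ pullback.condition))
      (pullback.snd (p.eval.map (q.evalFst A)) (triProj p q) ≫ p.triSnd q)
      (evalComp_snd _ _ pullback.condition))

/-- The inverse comparison map, given by currying. -/
def evalCompInv (A : E) : (p.tri q).eval.obj A ⟶ p.eval.obj (q.eval.obj A) :=
  p.evalMk ((p.tri q).evalFst A ≫ p.evalFst q.pos)
    (q.evalMk
      (p.evalAt (pullback.fst ((p.tri q).evalFst A ≫ p.evalFst q.pos) p.proj ≫ (p.tri q).evalFst A)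
        (pullback.snd ((p.tri q).evalFst A ≫ p.evalFst q.pos) p.proj)
        ((Category.assoc _ _ _).trans pullback.condition))
      ((p.tri q).evalAt
        (pullback.fst _ q.proj ≫ pullback.fst ((p.tri q).evalFst A ≫ p.evalFst q.pos) p.proj)
        (triMk
          (pullback.fst _ q.proj ≫ pullback.fst ((p.tri q).evalFst A ≫ p.evalFst q.pos) p.proj ≫
            (p.tri q).evalFst A)
          (pullback.fst _ q.proj ≫ pullback.snd ((p.tri q).evalFst A ≫ p.evalFst q.pos) p.proj)
          (pullback.snd _ q.proj)
          (by simp [pullback.condition])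
          ((comp_evalAt _ _ _ _ _).symm.trans pullback.condition))
        (by simp)))

variable {p q}

@[simp]
theorem evalCompHom_fst (A : E) :
    p.evalCompHom q A ≫ (p.tri q).evalFst A = p.eval.map (q.evalFst A) :=
  evalMk_fst _ _ _

@[simp]
theorem evalCompHom_fst_assoc (A : E) {Z : E} (k : p.eval.obj q.pos ⟶ Z) :
    p.evalCompHom q A ≫ (p.tri q).evalFst A ≫ k = p.eval.map (q.evalFst A) ≫ k := by
  rw [← Category.assoc, evalCompHom_fst]

theorem evalAt_evalCompHom {A B : E} (z : B ⟶ p.eval.obj (q.eval.obj A)) (t : B ⟶ triDir p q)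
    (w : (z ≫ p.evalCompHom q A) ≫ (p.tri q).evalFst A = t ≫ triProj p q)
    (w' : z ≫ p.eval.map (q.evalFst A) = t ≫ triProj p q) :
    (p.tri q).evalAt (z ≫ p.evalCompHom q A) t w =
      q.evalAt (p.evalAt z (t ≫ p.triFst q) (evalComp_fst z t w')) (t ≫ p.triSnd q)
        (evalComp_snd z t w') := by
  refine ((p.tri q).evalAt_evalMk _ _ _ _ _).trans ?_
  exact q.comp_evalAt_eq _ _ _ _ (p.comp_evalAt_eq _ _ _ _ (pullback.lift_fst _ _ _)
    (pullback.lift_snd_assoc _ _ _ _)) (pullback.lift_snd_assoc _ _ _ _)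

@[simp]
theorem evalCompInv_fst (A : E) :
    p.evalCompInv q A ≫ p.evalFst (q.eval.obj A) = (p.tri q).evalFst A ≫ p.evalFst q.pos :=
  evalMk_fst _ _ _

@[simp]
theorem evalCompInv_fst_assoc (A : E) {Z : E} (k : p.pos ⟶ Z) :
    p.evalCompInv q A ≫ p.evalFst (q.eval.obj A) ≫ k =
      (p.tri q).evalFst A ≫ p.evalFst q.pos ≫ k := by
  rw [← Category.assoc, evalCompInv_fst, Category.assoc]

theorem evalAt_evalCompInv_fst {A B : E} (z : B ⟶ (p.tri q).eval.obj A) (x : B ⟶ p.dir)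
    (w : (z ≫ p.evalCompInv q A) ≫ p.evalFst (q.eval.obj A) = x ≫ p.proj) :
    p.evalAt (z ≫ p.evalCompInv q A) x w ≫ q.evalFst A =
      p.evalAt (z ≫ (p.tri q).evalFst A) x (by simpa using w) := by
  refine (congrArg (fun k => k ≫ q.evalFst A) (p.evalAt_evalMk _ _ _ _ _)).trans ?_
  refine (Category.assoc _ _ _).trans ((congrArg (fun k => _ ≫ k) (evalMk_fst _ _ _)).trans ?_)
  exact p.comp_evalAt_eq _ _ _ _ (pullback.lift_fst_assoc _ _ _ _) (pullback.lift_snd _ _ _)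

theorem evalAt_evalAt_evalCompInv {A B : E} (z : B ⟶ (p.tri q).eval.obj A) (x : B ⟶ p.dir)
    (y : B ⟶ q.dir) (w : (z ≫ p.evalCompInv q A) ≫ p.evalFst (q.eval.obj A) = x ≫ p.proj)
    (w' : p.evalAt (z ≫ p.evalCompInv q A) x w ≫ q.evalFst A = y ≫ q.proj) :
    q.evalAt (p.evalAt (z ≫ p.evalCompInv q A) x w) y w' =
      (p.tri q).evalAt z (triMk (z ≫ (p.tri q).evalFst A) x y (by simpa using w)
        ((evalAt_evalCompInv_fst z x w).symm.trans w')) (by simp) := by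
  refine (q.evalAt_congr (p.evalAt_evalMk _ _ _ _ _) rfl _).trans ?_
  refine (q.evalAt_evalMk _ _ _ _ _).trans ?_
  refine comp_evalAt_eq _ _ _ _ _ ?_ (comp_triMk_eq _ _ _ ?_ ?_ ?_)
  · exact (pullback.lift_fst_assoc _ _ _ _).trans (pullback.lift_fst _ _ _)
  · exact (pullback.lift_fst_assoc _ _ _ _).trans (pullback.lift_fst_assoc _ _ _ _)
  · exact (pullback.lift_fst_assoc _ _ _ _).trans (pullback.lift_snd _ _ _)
  · exact pullback.lift_snd _ _ _

@[simp]
theorem evalCompInv_map (A : E) :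
    p.evalCompInv q A ≫ p.eval.map (q.evalFst A) = (p.tri q).evalFst A := by
  refine eval_hom_ext _ (by simp) (fun b x w w' => ?_)
  rw [p.evalAt_congr (Category.assoc _ _ _).symm rfl, evalAt_comp_eval_map, evalAt_evalCompInv_fst]

@[simp]
theorem evalCompHom_inv (A : E) : p.evalCompHom q A ≫ p.evalCompInv q A = 𝟙 _ := by
  refine eval_hom_ext _ (by simp) (fun b x w w' => ?_)
  have e := Category.assoc b (p.evalCompHom q A) (p.evalCompInv q A)
  have e' : b ≫ 𝟙 (p.eval.obj (q.eval.obj A)) = b := Category.comp_id b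
  rw [evalAt_congr _ e.symm rfl, evalAt_congr _ e' rfl]
  refine eval_hom_ext _ ?_ (fun b' y w₁ w₁' => ?_)
  · rw [evalAt_evalCompInv_fst, ← evalAt_comp_eval_map]
    · exact evalAt_congr _ (by simp) rfl _
  · have e₁ : b' ≫ p.evalAt ((b ≫ p.evalCompHom q A) ≫ p.evalCompInv q A) x
        (by rw [e]; exact w) = p.evalAt (((b' ≫ b) ≫ p.evalCompHom q A) ≫
        p.evalCompInv q A) (b' ≫ x) (by simpa using congrArg (fun k => b' ≫ k) w) :=
      comp_evalAt_eq _ _ _ _ _ (by simp) rfl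
    rw [evalAt_congr _ e₁ rfl, evalAt_evalAt_evalCompInv]
    refine (evalAt_evalCompHom _ _ _ (by simp)).trans ?_
    exact evalAt_congr _ ((evalAt_congr _ rfl (by simp) _).trans
        (comp_evalAt _ _ _ _ _).symm) (by simp) _

@[simp]
theorem evalCompHom_inv_assoc (A : E) {Z : E} (k : p.eval.obj (q.eval.obj A) ⟶ Z) :
    p.evalCompHom q A ≫ p.evalCompInv q A ≫ k = k := by
  rw [← Category.assoc, evalCompHom_inv, Category.id_comp]

@[simp]
theorem evalCompInv_hom (A : E) : p.evalCompInv q A ≫ p.evalCompHom q A = 𝟙 _ := by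
  refine eval_hom_ext _ (by simp) (fun b t w w' => ?_)
  have e := Category.assoc b (p.evalCompInv q A) (p.evalCompHom q A)
  have e' : b ≫ 𝟙 ((p.tri q).eval.obj A) = b := Category.comp_id b
  have h : b ≫ (p.tri q).evalFst A = t ≫ triProj p q := by simpa [e'] using w'
  rw [evalAt_congr _ e.symm rfl, evalAt_congr _ e' rfl, evalAt_evalCompHom,
    evalAt_evalAt_evalCompInv]
  · exact evalAt_congr _ rfl (tri_hom_ext (by simp [h]) (by simp) (by simp)) _
  · simpa using h

@[simp]
theorem evalCompInv_hom_assoc (A : E) {Z : E} (k : (p.tri q).eval.obj A ⟶ Z) :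
    p.evalCompInv q A ≫ p.evalCompHom q A ≫ k = k := by
  rw [← Category.assoc, evalCompInv_hom, Category.id_comp]

theorem evalCompHom_naturality {A A' : E} (h : A ⟶ A') :
    p.eval.map (q.eval.map h) ≫ p.evalCompHom q A' =
      p.evalCompHom q A ≫ (p.tri q).eval.map h := by
  refine eval_hom_ext _ (by simp [← Functor.map_comp]) (fun b t w w' => ?_)
  have hw : b ≫ p.eval.map (q.evalFst A) = t ≫ triProj p q := by
    simpa using w'
  have e := Category.assoc b (p.eval.map (q.eval.map h)) (p.evalCompHom q A')
  have e' := Category.assoc b (p.evalCompHom q A) ((p.tri q).eval.map h)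
  refine (evalAt_congr _ e.symm rfl _).trans ?_
  refine Eq.trans ?_ (evalAt_congr _ e' rfl (by rw [e']; exact w'))
  refine (evalAt_evalCompHom (b ≫ p.eval.map (q.eval.map h)) t _ ?_).trans ?_
  · simpa [← Functor.map_comp] using hw
  refine (evalAt_congr _ (evalAt_comp_eval_map _ _ _ _ _) rfl _).trans ?_
  refine (evalAt_comp_eval_map _ _ _ _ _).trans ?_
  refine Eq.trans ?_ (evalAt_comp_eval_map _ _ _ _ (by rw [e']; exact w')).symm
  exact congrArg (fun k => k ≫ h) (evalAt_evalCompHom _ _ _ hw).symm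

variable (p q) in
/-- The polynomial functor of a composition product is the composite of the polynomial functors. -/
def evalComp : q.eval ⋙ p.eval ≅ (p.tri q).eval :=
  NatIso.ofComponents
    (fun A =>
      { hom := p.evalCompHom q A
        inv := p.evalCompInv q A
        hom_inv_id := evalCompHom_inv A
        inv_hom_id := evalCompInv_hom A })
    evalCompHom_naturality

end

/-! ### The monoidal structure -/

section

variable {p q p' q' : PolyIn E}

theorem triMap_fst (φ : p ⟶ p') (ψ : q ⟶ q') {B : E} (b : B ⟶ p.eval.obj q.pos)
    (t : B ⟶ triDir p' q')
    (w : b ≫ evalMapApp φ q.pos ≫ p'.eval.map ψ.onPos = t ≫ triProj p' q') :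
    (b ≫ p.evalFst q.pos) ≫ φ.onPos = (t ≫ p'.triFst q') ≫ p'.proj := by
  simpa [triProj_fst] using congrArg (fun k => k ≫ p'.evalFst q'.pos) w

theorem triMap_snd (φ : p ⟶ p') (ψ : q ⟶ q') {B : E} (b : B ⟶ p.eval.obj q.pos)
    (t : B ⟶ triDir p' q')
    (w : b ≫ evalMapApp φ q.pos ≫ p'.eval.map ψ.onPos = t ≫ triProj p' q') :
    p.evalAt b (φ.dirAt (b ≫ p.evalFst q.pos) (t ≫ p'.triFst q') (triMap_fst φ ψ b t w))
      (by simp) ≫ ψ.onPos = (t ≫ p'.triSnd q') ≫ q'.proj := by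
  rw [← triSnd_at (b ≫ evalMapApp φ q.pos ≫ p'.eval.map ψ.onPos) t w,
    p'.evalAt_congr (Category.assoc b (evalMapApp φ q.pos) (p'.eval.map ψ.onPos)).symm rfl,
    evalAt_comp_eval_map, evalAt_evalMapApp]

/-- The direction of `p.tri q` assigned by `φ` and `ψ` to a direction of `p'.tri q'`: apply `φ` to
the `p'`-direction and `ψ` to the `q'`-direction. -/
def triMapDir (φ : p ⟶ p') (ψ : q ⟶ q') {B : E} (b : B ⟶ p.eval.obj q.pos)
    (t : B ⟶ triDir p' q')
    (w : b ≫ evalMapApp φ q.pos ≫ p'.eval.map ψ.onPos = t ≫ triProj p' q') : B ⟶ triDir p q :=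
  triMk b (φ.dirAt (b ≫ p.evalFst q.pos) (t ≫ p'.triFst q') (triMap_fst φ ψ b t w))
    (ψ.dirAt (p.evalAt b (φ.dirAt (b ≫ p.evalFst q.pos) (t ≫ p'.triFst q')
      (triMap_fst φ ψ b t w)) (by simp)) (t ≫ p'.triSnd q') (triMap_snd φ ψ b t w))
    (by simp) (by simp)

/-- The composition product of morphisms of polynomials. -/
def triMap (φ : p ⟶ p') (ψ : q ⟶ q') : p.tri q ⟶ p'.tri q' where
  onPos := evalMapApp φ q.pos ≫ p'.eval.map ψ.onPos
  onDir := triMapDir φ ψ (pullback.fst _ (triProj p' q')) (pullback.snd _ (triProj p' q'))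
    pullback.condition
  onDir_proj := triMk_proj _ _ _ _ _

theorem triMap_dirAt (φ : p ⟶ p') (ψ : q ⟶ q') {B : E} (b : B ⟶ p.eval.obj q.pos)
    (t : B ⟶ triDir p' q')
    (w : b ≫ evalMapApp φ q.pos ≫ p'.eval.map ψ.onPos = t ≫ triProj p' q') :
    Hom.dirAt (triMap φ ψ) b t w = triMapDir φ ψ b t w := by
  refine comp_triMk_eq _ _ _ ?_ ?_ ?_
  · exact pullback.lift_fst _ _ _
  · exact φ.comp_dirAt_eq _ _ _ _ (pullback.lift_fst_assoc _ _ _ _) (pullback.lift_snd_assoc _ _ _ _)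
  · refine ψ.comp_dirAt_eq _ _ _ _ ?_ (pullback.lift_snd_assoc _ _ _ _)
    exact p.comp_evalAt_eq _ _ _ _ (pullback.lift_fst _ _ _)
      (φ.comp_dirAt_eq _ _ _ _ (pullback.lift_fst_assoc _ _ _ _) (pullback.lift_snd_assoc _ _ _ _))

theorem evalMapApp_triMap (φ : p ⟶ p') (ψ : q ⟶ q') (A : E) :
    p.evalCompHom q A ≫ evalMapApp (triMap φ ψ) A =
      evalMapApp φ (q.eval.obj A) ≫ p'.eval.map (evalMapApp ψ A) ≫ p'.evalCompHom q' A := by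
  have hpos : (p.evalCompHom q A ≫ evalMapApp (triMap φ ψ) A) ≫ (p'.tri q').evalFst A =
      p.eval.map (q.evalFst A) ≫ evalMapApp φ q.pos ≫ p'.eval.map ψ.onPos := by
    rw [Category.assoc, evalMapApp_fst, evalCompHom_fst_assoc]
    rfl
  refine eval_hom_ext _ (hpos.trans ?_) (fun b t w w' => ?_)
  · simp only [Category.assoc, evalCompHom_fst, evalMapApp_naturality_assoc, ← Functor.map_comp,
      evalMapApp_fst]
  · have e := Category.assoc b (p.evalCompHom q A) (evalMapApp (triMap φ ψ) A)
    have e₁ : ((b ≫ evalMapApp φ (q.eval.obj A)) ≫ p'.eval.map (evalMapApp ψ A)) ≫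
        p'.evalCompHom q' A = b ≫ evalMapApp φ (q.eval.obj A) ≫ p'.eval.map (evalMapApp ψ A) ≫
        p'.evalCompHom q' A := by simp only [Category.assoc]
    have h₁ : (b ≫ p.evalCompHom q A) ≫ (p.tri q).evalFst A = b ≫ p.eval.map (q.evalFst A) := by
      rw [Category.assoc, evalCompHom_fst]
    have w₂ : (b ≫ p.eval.map (q.evalFst A)) ≫ evalMapApp φ q.pos ≫ p'.eval.map ψ.onPos =
        t ≫ triProj p' q' := by
      rw [Category.assoc, ← hpos, ← Category.assoc]
      exact w
    have w₃ : ((b ≫ evalMapApp φ (q.eval.obj A)) ≫ p'.eval.map (evalMapApp ψ A)) ≫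
        p'.eval.map (q'.evalFst A) = t ≫ triProj p' q' := by
      simpa using w'
    have h₂ : Hom.dirAt (triMap φ ψ) ((b ≫ p.evalCompHom q A) ≫ (p.tri q).evalFst A) t
        (by rw [h₁]; exact w₂) = triMapDir φ ψ (b ≫ p.eval.map (q.evalFst A)) t w₂ :=
      (Hom.dirAt_congr _ h₁ rfl _).trans (triMap_dirAt φ ψ _ t w₂)
    have h₃ : φ.dirAt ((b ≫ p.eval.map (q.evalFst A)) ≫ p.evalFst q.pos) (t ≫ p'.triFst q')
        (triMap_fst φ ψ _ t w₂) = φ.dirAt (b ≫ p.evalFst (q.eval.obj A)) (t ≫ p'.triFst q')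
        (by simpa using triMap_fst φ ψ _ t w₂) :=
      φ.dirAt_congr (by simp) rfl _
    have h₄ : p'.evalAt ((b ≫ evalMapApp φ (q.eval.obj A)) ≫ p'.eval.map (evalMapApp ψ A))
        (t ≫ p'.triFst q') (evalComp_fst _ t w₃) =
        p.evalAt b (φ.dirAt (b ≫ p.evalFst (q.eval.obj A)) (t ≫ p'.triFst q')
        (by simpa using triMap_fst φ ψ _ t w₂)) (by simp) ≫ evalMapApp ψ A :=
      (evalAt_comp_eval_map _ _ _ _ _).trans
        (congrArg (fun k => k ≫ evalMapApp ψ A) (evalAt_evalMapApp _ _ _ _))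
    have w₄ := evalComp_snd _ t w₃
    rw [h₄] at w₄
    refine (evalAt_congr _ e.symm rfl _).trans (Eq.trans ?_ (evalAt_congr _ e₁ rfl
      (by rw [e₁]; exact w')))
    refine (evalAt_evalMapApp _ _ _ _).trans ?_
    refine (evalAt_congr _ rfl h₂ _).trans ?_
    refine (evalAt_evalCompHom _ _ _ (triMk_proj _ _ _ _ _).symm).trans ?_
    refine Eq.trans ?_ (evalAt_evalCompHom _ _ _ w₃).symm
    refine Eq.trans ?_ ((evalAt_congr _ h₄ rfl _).trans (evalAt_evalMapApp _ _ _ w₄)).symm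
    have h₅ : p.evalAt b (triMapDir φ ψ (b ≫ p.eval.map (q.evalFst A)) t w₂ ≫ p.triFst q)
        (evalComp_fst _ _ (triMk_proj _ _ _ _ _).symm) =
        p.evalAt b (φ.dirAt (b ≫ p.evalFst (q.eval.obj A)) (t ≫ p'.triFst q')
        (by simpa using triMap_fst φ ψ _ t w₂)) (by simp) :=
      evalAt_congr _ rfl ((triMk_fst _ _ _ _ _).trans h₃) _
    refine evalAt_congr _ h₅ ?_ _
    refine (triMk_snd _ _ _ _ _).trans (ψ.dirAt_congr ?_ rfl _)
    refine (evalAt_comp_eval_map _ _ _ _ _).trans ?_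
    exact congrArg (fun k => k ≫ q.evalFst A) (evalAt_congr _ rfl h₃ _)

end


section

variable {p q r : PolyIn E}

theorem assocHomDir_snd {B : E} (a : B ⟶ (p.tri q).eval.obj r.pos) (t : B ⟶ triDir p (q.tri r))
    (w : a ≫ p.evalCompInv q r.pos = t ≫ triProj p (q.tri r)) :
    p.evalAt (a ≫ p.evalCompInv q r.pos) (t ≫ p.triFst (q.tri r)) (triFst_at _ t w) =
      (t ≫ p.triSnd (q.tri r)) ≫ triProj q r :=
  triSnd_at _ t w

theorem assocHomDir_fst {B : E} (a : B ⟶ (p.tri q).eval.obj r.pos) (t : B ⟶ triDir p (q.tri r))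
    (w : a ≫ p.evalCompInv q r.pos = t ≫ triProj p (q.tri r)) :
    (a ≫ (p.tri q).evalFst r.pos) ≫ p.evalFst q.pos = (t ≫ p.triFst (q.tri r)) ≫ p.proj := by
  rw [Category.assoc, ← evalCompInv_fst, ← triFst_at _ t w, Category.assoc]

theorem assocHomDir_mid {B : E} (a : B ⟶ (p.tri q).eval.obj r.pos) (t : B ⟶ triDir p (q.tri r))
    (w : a ≫ p.evalCompInv q r.pos = t ≫ triProj p (q.tri r)) :
    p.evalAt (a ≫ (p.tri q).evalFst r.pos) (t ≫ p.triFst (q.tri r)) (assocHomDir_fst a t w) =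
      ((t ≫ p.triSnd (q.tri r)) ≫ q.triFst r) ≫ q.proj := by
  rw [← evalAt_evalCompInv_fst a _ (triFst_at _ t w), assocHomDir_snd a t w, Category.assoc,
    triProj_fst, ← Category.assoc]

theorem assocHomDir_last {B : E} (a : B ⟶ (p.tri q).eval.obj r.pos) (t : B ⟶ triDir p (q.tri r))
    (w : a ≫ p.evalCompInv q r.pos = t ≫ triProj p (q.tri r)) :
    (p.tri q).evalAt a (triMk (a ≫ (p.tri q).evalFst r.pos) (t ≫ p.triFst (q.tri r))
      ((t ≫ p.triSnd (q.tri r)) ≫ q.triFst r) (assocHomDir_fst a t w) (assocHomDir_mid a t w))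
      (triMk_proj _ _ _ _ _).symm =
      ((t ≫ p.triSnd (q.tri r)) ≫ q.triSnd r) ≫ r.proj := by
  refine (evalAt_evalAt_evalCompInv a _ _ (triFst_at _ t w) ?_).symm.trans ?_
  · rw [assocHomDir_snd a t w, Category.assoc, triProj_fst, ← Category.assoc]
  · exact triSnd_at _ _ (assocHomDir_snd a t w)

/-- Reassociation of directions. -/
def assocHomDir {B : E} (a : B ⟶ (p.tri q).eval.obj r.pos) (t : B ⟶ triDir p (q.tri r))
    (w : a ≫ p.evalCompInv q r.pos = t ≫ triProj p (q.tri r)) : B ⟶ triDir (p.tri q) r :=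
  triMk a (triMk (a ≫ (p.tri q).evalFst r.pos) (t ≫ p.triFst (q.tri r))
      ((t ≫ p.triSnd (q.tri r)) ≫ q.triFst r) (assocHomDir_fst a t w) (assocHomDir_mid a t w))
    ((t ≫ p.triSnd (q.tri r)) ≫ q.triSnd r) (triMk_proj _ _ _ _ _).symm (assocHomDir_last a t w)

/-- The direction triple of `assocHomDir` is that of `t`. -/
theorem comp_assocHomDir {B C : E} (u : C ⟶ B) (a : B ⟶ (p.tri q).eval.obj r.pos)
    (t : B ⟶ triDir p (q.tri r))
    (w : a ≫ p.evalCompInv q r.pos = t ≫ triProj p (q.tri r)) {a' : C ⟶ (p.tri q).eval.obj r.pos}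
    {t' : C ⟶ triDir p (q.tri r)} (ha : u ≫ a = a') (ht : u ≫ t = t') :
    u ≫ assocHomDir a t w = assocHomDir a' t' (by simp [← ha, ← ht, w]) := by
  subst ha ht
  exact comp_triMk_eq _ _ _ rfl (comp_triMk_eq _ _ _ (Category.assoc _ _ _).symm
    (Category.assoc _ _ _).symm (by simp only [Category.assoc])) (by simp only [Category.assoc])

section

variable {B : E} (a : B ⟶ (p.tri q).eval.obj r.pos) (t : B ⟶ triDir p (q.tri r))
    (w : a ≫ p.evalCompInv q r.pos = t ≫ triProj p (q.tri r))

theorem assocHomDir_proj : assocHomDir a t w ≫ triProj (p.tri q) r = a :=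
  triMk_proj _ _ _ _ _

theorem assocHomDir_fst_proj : (assocHomDir a t w ≫ (p.tri q).triFst r) ≫ triProj p q =
    a ≫ (p.tri q).evalFst r.pos :=
  (congrArg (fun k => k ≫ triProj p q) (triMk_fst _ _ _ _ _)).trans (triMk_proj _ _ _ _ _)

theorem assocHomDir_fst_fst : (assocHomDir a t w ≫ (p.tri q).triFst r) ≫ p.triFst q =
    t ≫ p.triFst (q.tri r) :=
  (congrArg (fun k => k ≫ p.triFst q) (triMk_fst _ _ _ _ _)).trans (triMk_fst _ _ _ _ _)

theorem assocHomDir_fst_snd : (assocHomDir a t w ≫ (p.tri q).triFst r) ≫ p.triSnd q =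
    (t ≫ p.triSnd (q.tri r)) ≫ q.triFst r :=
  (congrArg (fun k => k ≫ p.triSnd q) (triMk_fst _ _ _ _ _)).trans (triMk_snd _ _ _ _ _)

theorem assocHomDir_snd' : assocHomDir a t w ≫ (p.tri q).triSnd r =
    (t ≫ p.triSnd (q.tri r)) ≫ q.triSnd r :=
  triMk_snd _ _ _ _ _

end

variable (p q r) in
/-- The associator, from left to right. -/
def assocHom : (p.tri q).tri r ⟶ p.tri (q.tri r) where
  onPos := p.evalCompInv q r.pos
  onDir := assocHomDir (pullback.fst _ _) (pullback.snd _ _) pullback.condition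
  onDir_proj := triMk_proj _ _ _ _ _

theorem assocHom_dirAt {B : E} (a : B ⟶ (p.tri q).eval.obj r.pos) (t : B ⟶ triDir p (q.tri r))
    (w : a ≫ p.evalCompInv q r.pos = t ≫ triProj p (q.tri r)) :
    Hom.dirAt (assocHom p q r) a t w = assocHomDir a t w :=
  comp_assocHomDir _ _ _ pullback.condition (pullback.lift_fst _ _ _) (pullback.lift_snd _ _ _)

theorem assocInvDir_fst {B : E} (a : B ⟶ p.eval.obj (q.eval.obj r.pos))
    (t : B ⟶ triDir (p.tri q) r) (w : a ≫ p.evalCompHom q r.pos = t ≫ triProj (p.tri q) r) :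
    a ≫ p.eval.map (q.evalFst r.pos) = (t ≫ (p.tri q).triFst r) ≫ triProj p q :=
  (by simp : _ = (a ≫ p.evalCompHom q r.pos) ≫ (p.tri q).evalFst r.pos).trans (triFst_at _ t w)

theorem assocInvDir_last {B : E} (a : B ⟶ p.eval.obj (q.eval.obj r.pos))
    (t : B ⟶ triDir (p.tri q) r) (w : a ≫ p.evalCompHom q r.pos = t ≫ triProj (p.tri q) r) :
    q.evalAt (p.evalAt a ((t ≫ (p.tri q).triFst r) ≫ p.triFst q)
      (evalComp_fst a _ (assocInvDir_fst a t w))) ((t ≫ (p.tri q).triFst r) ≫ p.triSnd q)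
      (evalComp_snd a _ (assocInvDir_fst a t w)) = (t ≫ (p.tri q).triSnd r) ≫ r.proj :=
  (evalAt_evalCompHom a _ (triFst_at _ t w) (assocInvDir_fst a t w)).symm.trans (triSnd_at _ t w)

/-- Reassociation of directions, backwards. -/
def assocInvDir {B : E} (a : B ⟶ p.eval.obj (q.eval.obj r.pos))
    (t : B ⟶ triDir (p.tri q) r) (w : a ≫ p.evalCompHom q r.pos = t ≫ triProj (p.tri q) r) :
    B ⟶ triDir p (q.tri r) :=
  triMk a ((t ≫ (p.tri q).triFst r) ≫ p.triFst q)
    (triMk (p.evalAt a ((t ≫ (p.tri q).triFst r) ≫ p.triFst q)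
      (evalComp_fst a _ (assocInvDir_fst a t w))) ((t ≫ (p.tri q).triFst r) ≫ p.triSnd q)
      (t ≫ (p.tri q).triSnd r) (evalComp_snd a _ (assocInvDir_fst a t w))
      (assocInvDir_last a t w))
    (evalComp_fst a _ (assocInvDir_fst a t w)) (triMk_proj _ _ _ _ _).symm

theorem comp_assocInvDir {B C : E} (u : C ⟶ B) (a : B ⟶ p.eval.obj (q.eval.obj r.pos))
    (t : B ⟶ triDir (p.tri q) r) (w : a ≫ p.evalCompHom q r.pos = t ≫ triProj (p.tri q) r)
    {a' : C ⟶ p.eval.obj (q.eval.obj r.pos)} {t' : C ⟶ triDir (p.tri q) r}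
    (ha : u ≫ a = a') (ht : u ≫ t = t') :
    u ≫ assocInvDir a t w = assocInvDir a' t' (by simp [← ha, ← ht, w]) := by
  subst ha ht
  refine comp_triMk_eq _ _ _ rfl (by simp only [Category.assoc]) (comp_triMk_eq _ _ _ ?_
    (by simp only [Category.assoc]) (Category.assoc _ _ _).symm)
  exact comp_evalAt_eq _ _ _ _ _ rfl (by simp only [Category.assoc])

section

variable {B : E} (a : B ⟶ p.eval.obj (q.eval.obj r.pos)) (t : B ⟶ triDir (p.tri q) r)
    (w : a ≫ p.evalCompHom q r.pos = t ≫ triProj (p.tri q) r)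

theorem assocInvDir_proj : assocInvDir a t w ≫ triProj p (q.tri r) = a :=
  triMk_proj _ _ _ _ _

theorem assocInvDir_fst' : assocInvDir a t w ≫ p.triFst (q.tri r) =
    (t ≫ (p.tri q).triFst r) ≫ p.triFst q :=
  triMk_fst _ _ _ _ _

theorem assocInvDir_snd_proj : (assocInvDir a t w ≫ p.triSnd (q.tri r)) ≫ triProj q r =
    p.evalAt a ((t ≫ (p.tri q).triFst r) ≫ p.triFst q)
      (evalComp_fst a _ (assocInvDir_fst a t w)) :=
  (congrArg (fun k => k ≫ triProj q r) (triMk_snd _ _ _ _ _)).trans (triMk_proj _ _ _ _ _)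

theorem assocInvDir_snd_fst : (assocInvDir a t w ≫ p.triSnd (q.tri r)) ≫ q.triFst r =
    (t ≫ (p.tri q).triFst r) ≫ p.triSnd q :=
  (congrArg (fun k => k ≫ q.triFst r) (triMk_snd _ _ _ _ _)).trans (triMk_fst _ _ _ _ _)

theorem assocInvDir_snd_snd : (assocInvDir a t w ≫ p.triSnd (q.tri r)) ≫ q.triSnd r =
    t ≫ (p.tri q).triSnd r :=
  (congrArg (fun k => k ≫ q.triSnd r) (triMk_snd _ _ _ _ _)).trans (triMk_snd _ _ _ _ _)

end

variable (p q r) in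
/-- The associator, from right to left. -/
def assocInv : p.tri (q.tri r) ⟶ (p.tri q).tri r where
  onPos := p.evalCompHom q r.pos
  onDir := assocInvDir (pullback.fst _ _) (pullback.snd _ _) pullback.condition
  onDir_proj := triMk_proj _ _ _ _ _

theorem assocInv_dirAt {B : E} (a : B ⟶ p.eval.obj (q.eval.obj r.pos))
    (t : B ⟶ triDir (p.tri q) r) (w : a ≫ p.evalCompHom q r.pos = t ≫ triProj (p.tri q) r) :
    Hom.dirAt (assocInv p q r) a t w = assocInvDir a t w :=
  comp_assocInvDir _ _ _ pullback.condition (pullback.lift_fst _ _ _) (pullback.lift_snd _ _ _)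

theorem assocHomDir_assocInvDir {B : E} (a : B ⟶ (p.tri q).eval.obj r.pos)
    (t : B ⟶ triDir (p.tri q) r) (ha : a = t ≫ triProj (p.tri q) r)
    (w : (a ≫ p.evalCompInv q r.pos) ≫ p.evalCompHom q r.pos = t ≫ triProj (p.tri q) r) :
    assocHomDir a (assocInvDir (a ≫ p.evalCompInv q r.pos) t w) (assocInvDir_proj _ _ _).symm =
      t := by
  refine tri_hom_ext ((assocHomDir_proj _ _ _).trans ha) (tri_hom_ext ?_ ?_ ?_) ?_
  · exact (assocHomDir_fst_proj _ _ _).trans (triFst_at _ t ha)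
  · exact (assocHomDir_fst_fst _ _ _).trans (assocInvDir_fst' _ _ _)
  · exact (assocHomDir_fst_snd _ _ _).trans (assocInvDir_snd_fst _ _ _)
  · exact (assocHomDir_snd' _ _ _).trans (assocInvDir_snd_snd _ _ _)

theorem assocInvDir_assocHomDir {B : E} (a : B ⟶ p.eval.obj (q.eval.obj r.pos))
    (t : B ⟶ triDir p (q.tri r)) (ha : a = t ≫ triProj p (q.tri r))
    (w : (a ≫ p.evalCompHom q r.pos) ≫ p.evalCompInv q r.pos = t ≫ triProj p (q.tri r)) :
    assocInvDir a (assocHomDir (a ≫ p.evalCompHom q r.pos) t w) (assocHomDir_proj _ _ _).symm =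
      t := by
  refine tri_hom_ext ((assocInvDir_proj _ _ _).trans ha) ?_ (tri_hom_ext ?_ ?_ ?_)
  · exact (assocInvDir_fst' _ _ _).trans (assocHomDir_fst_fst _ _ _)
  · refine (assocInvDir_snd_proj _ _ _).trans ?_
    exact (evalAt_congr _ rfl (assocHomDir_fst_fst _ _ _) _).trans (triSnd_at _ t ha)
  · exact (assocInvDir_snd_fst _ _ _).trans (assocHomDir_fst_snd _ _ _)
  · exact (assocInvDir_snd_snd _ _ _).trans (assocHomDir_snd' _ _ _)

theorem assocHom_assocInv : assocHom p q r ≫ assocInv p q r = 𝟙 _ := by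
  refine Hom.ext_dirAt (evalCompInv_hom _) (fun a t w w' => ?_)
  have ha : a = t ≫ triProj (p.tri q) r := (Category.comp_id a).symm.trans w'
  have hw : (a ≫ p.evalCompInv q r.pos) ≫ p.evalCompHom q r.pos = t ≫ triProj (p.tri q) r :=
    (Category.assoc _ _ _).trans w
  have h := assocInv_dirAt (a ≫ p.evalCompInv q r.pos) t hw
  have h₂ := assocHom_dirAt a _ (assocInvDir_proj (a ≫ p.evalCompInv q r.pos) t hw).symm
  have h₃ := assocHomDir_assocInvDir a t ha hw
  exact ((comp_dirAt _ _ _ _ _).trans ((Hom.dirAt_congr _ rfl h _).trans h₂)).trans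
    (h₃.trans (id_dirAt _ _ _ _).symm)

theorem assocInv_assocHom : assocInv p q r ≫ assocHom p q r = 𝟙 _ := by
  refine Hom.ext_dirAt (evalCompHom_inv _) (fun a t w w' => ?_)
  have ha : a = t ≫ triProj p (q.tri r) := (Category.comp_id a).symm.trans w'
  have hw : (a ≫ p.evalCompHom q r.pos) ≫ p.evalCompInv q r.pos = t ≫ triProj p (q.tri r) :=
    (Category.assoc _ _ _).trans w
  have h := assocHom_dirAt (a ≫ p.evalCompHom q r.pos) t hw
  have h₂ := assocInv_dirAt a _ (assocHomDir_proj (a ≫ p.evalCompHom q r.pos) t hw).symm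
  have h₃ := assocInvDir_assocHomDir a t ha hw
  exact ((comp_dirAt _ _ _ _ _).trans ((Hom.dirAt_congr _ rfl h _).trans h₂)).trans
    (h₃.trans (id_dirAt _ _ _ _).symm)

variable (p q r) in
/-- The associator. -/
def assoc : (p.tri q).tri r ≅ p.tri (q.tri r) where
  hom := assocHom p q r
  inv := assocInv p q r
  hom_inv_id := assocHom_assocInv
  inv_hom_id := assocInv_assocHom

end

section

variable {p q r : PolyIn E}

theorem evalCompInv_naturality {A A' : E} (h : A ⟶ A') :
    (p.tri q).eval.map h ≫ p.evalCompInv q A' =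
      p.evalCompInv q A ≫ p.eval.map (q.eval.map h) :=
  (evalComp p q).inv.naturality h

theorem evalCompInv_naturality_assoc {A A' Z : E} (h : A ⟶ A')
    (k : p.eval.obj (q.eval.obj A') ⟶ Z) :
    (p.tri q).eval.map h ≫ p.evalCompInv q A' ≫ k =
      p.evalCompInv q A ≫ p.eval.map (q.eval.map h) ≫ k := by
  rw [← Category.assoc, evalCompInv_naturality, Category.assoc]

theorem evalMapApp_assocHom (A : E) :
    (p.tri q).evalCompHom r A ≫ evalMapApp (assocHom p q r) A =
      p.evalCompInv q (r.eval.obj A) ≫ p.eval.map (q.evalCompHom r A) ≫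
        p.evalCompHom (q.tri r) A := by
  have hpos : ((p.tri q).evalCompHom r A ≫ evalMapApp (assocHom p q r) A) ≫
      (p.tri (q.tri r)).evalFst A = (p.tri q).eval.map (r.evalFst A) ≫ p.evalCompInv q r.pos := by
    rw [Category.assoc, evalMapApp_fst, evalCompHom_fst_assoc]
    rfl
  refine eval_hom_ext _ (hpos.trans ?_) (fun b t w w' => ?_)
  · simp only [Category.assoc, evalCompHom_fst, evalCompInv_naturality, ← Functor.map_comp]
  have e₁ : (b ≫ (p.tri q).evalCompHom r A) ≫ evalMapApp (assocHom p q r) A =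
      b ≫ (p.tri q).evalCompHom r A ≫ evalMapApp (assocHom p q r) A := Category.assoc _ _ _
  have e₂ : ((b ≫ p.evalCompInv q (r.eval.obj A)) ≫ p.eval.map (q.evalCompHom r A)) ≫
      p.evalCompHom (q.tri r) A = b ≫ p.evalCompInv q (r.eval.obj A) ≫
        p.eval.map (q.evalCompHom r A) ≫ p.evalCompHom (q.tri r) A := by simp only [Category.assoc]
  have hw : (b ≫ (p.tri q).eval.map (r.evalFst A)) ≫ p.evalCompInv q r.pos =
      t ≫ triProj p (q.tri r) := by
    rw [Category.assoc, ← hpos, ← Category.assoc]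
    exact w
  have hb : (b ≫ (p.tri q).evalCompHom r A) ≫ ((p.tri q).tri r).evalFst A =
      b ≫ (p.tri q).eval.map (r.evalFst A) := by
    rw [Category.assoc, evalCompHom_fst]
  have h₁ : Hom.dirAt (assocHom p q r)
      ((b ≫ (p.tri q).evalCompHom r A) ≫ ((p.tri q).tri r).evalFst A) t
      (by rw [hb]; exact hw) = assocHomDir (b ≫ (p.tri q).eval.map (r.evalFst A)) t hw :=
    (Hom.dirAt_congr _ hb rfl _).trans (assocHom_dirAt _ t hw)
  have hx : (b ≫ p.evalCompInv q (r.eval.obj A)) ≫ p.evalFst (q.eval.obj (r.eval.obj A)) =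
      (t ≫ p.triFst (q.tri r)) ≫ p.proj := by
    rw [Category.assoc t, ← triProj_fst, ← reassoc_of% hw]
    simp
  have hv : ((b ≫ p.evalCompInv q (r.eval.obj A)) ≫ p.eval.map (q.evalCompHom r A)) ≫
      p.eval.map ((q.tri r).evalFst A) = t ≫ triProj p (q.tri r) := by
    rw [← hw]
    simp only [Category.assoc, evalCompInv_naturality, ← Functor.map_comp, evalCompHom_fst]
  have h₂ := (p.evalAt_comp_eval_map (b ≫ p.evalCompInv q (r.eval.obj A))
    (t ≫ p.triFst (q.tri r)) (q.evalCompHom r A) (evalComp_fst _ _ hv))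
  have hs := evalComp_snd _ t hv
  rw [h₂] at hs
  have hs' : p.evalAt (b ≫ p.evalCompInv q (r.eval.obj A)) (t ≫ p.triFst (q.tri r)) hx ≫
      q.eval.map (r.evalFst A) = (t ≫ p.triSnd (q.tri r)) ≫ triProj q r := by
    refine Eq.trans ?_ hs
    rw [Category.assoc, evalCompHom_fst]
  have hp₁ := (assocHomDir_proj (b ≫ (p.tri q).eval.map (r.evalFst A)) t hw).symm
  have L := (evalAt_congr _ e₁.symm rfl w).trans ((evalAt_evalMapApp _ _ _ _).trans
    ((evalAt_congr _ rfl h₁ _).trans (evalAt_evalCompHom b _ (by rw [← hp₁, hb]) hp₁)))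
  have R := (evalAt_congr _ e₂.symm rfl w').trans ((evalAt_evalCompHom _ t _ hv).trans
    ((evalAt_congr _ h₂ rfl _).trans (evalAt_evalCompHom _ _ hs hs')))
  refine L.trans (Eq.trans ?_ R.symm)
  refine evalAt_congr _ ?_ (assocHomDir_snd' _ _ _) _
  refine Eq.trans ?_ (evalAt_evalAt_evalCompInv b _ _ hx (evalComp_fst _ _ hs')).symm
  refine evalAt_congr _ rfl (tri_hom_ext ?_ ?_ ?_) _
  · refine (assocHomDir_fst_proj _ _ _).trans (Eq.trans ?_ (triMk_proj _ _ _ _ _).symm)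
    rw [Category.assoc, eval_map_fst]
  · exact (assocHomDir_fst_fst _ _ _).trans (triMk_fst _ _ _ _ _).symm
  · exact (assocHomDir_fst_snd _ _ _).trans (triMk_snd _ _ _ _ _).symm

theorem comp_evalUnit_hom {A B : E} (z : B ⟶ (unit E).eval.obj A) (x : B ⟶ ⊤_ E) :
    (unit E).evalAt z x (Subsingleton.elim _ _) = z ≫ evalUnit.hom.app A :=
  (comp_evalAt_eq _ _ _ _ _ (Category.comp_id _) (Subsingleton.elim _ _)).symm

variable (p) in
/-- The left unitor, from left to right. -/
def leftHom : (unit E).tri p ⟶ p where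
  onPos := evalUnit.hom.app p.pos
  onDir := triMk (pullback.fst _ _) (terminal.from _) (pullback.snd _ _)
    (Subsingleton.elim _ _) ((comp_evalUnit_hom _ _).trans pullback.condition)
  onDir_proj := triMk_proj _ _ _ _ _

theorem leftHom_dirAt {B : E} (a : B ⟶ (unit E).eval.obj p.pos) (y : B ⟶ p.dir)
    (w : a ≫ evalUnit.hom.app p.pos = y ≫ p.proj) :
    Hom.dirAt (leftHom p) a y w = triMk a (terminal.from _) y
      (Subsingleton.elim _ _) ((comp_evalUnit_hom _ _).trans w) :=
  comp_triMk_eq _ _ _ (pullback.lift_fst _ _ _) (Subsingleton.elim _ _) (pullback.lift_snd _ _ _)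

variable (p) in
/-- The left unitor, from right to left. -/
def leftInv : p ⟶ (unit E).tri p where
  onPos := evalUnit.inv.app p.pos
  onDir := pullback.snd _ _ ≫ triSnd (unit E) p
  onDir_proj := by
    have h := triSnd_at _ (pullback.snd (evalUnit.inv.app p.pos) (triProj (unit E) p))
      pullback.condition
    refine h.symm.trans ?_
    exact (evalAt_evalMk _ _ _ _ _ _).trans (pullback.lift_fst _ _ _)

theorem leftInv_dirAt {B : E} (b : B ⟶ p.pos) (t : B ⟶ triDir (unit E) p)
    (w : b ≫ evalUnit.inv.app p.pos = t ≫ triProj (unit E) p) :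
    Hom.dirAt (leftInv p) b t w = t ≫ triSnd (unit E) p :=
  pullback.lift_snd_assoc _ _ _ _

variable (p) in
/-- The left unitor. -/
def leftUnit : (unit E).tri p ≅ p where
  hom := leftHom p
  inv := leftInv p
  hom_inv_id := by
    refine Hom.ext_dirAt (evalUnit.hom_inv_id_app p.pos) (fun a t w w' => ?_)
    have ha : a = t ≫ triProj (unit E) p := (Category.comp_id a).symm.trans w'
    have h₁ := leftInv_dirAt (a ≫ evalUnit.hom.app p.pos) t ((Category.assoc _ _ _).trans w)
    have hy : a ≫ evalUnit.hom.app p.pos = (t ≫ triSnd (unit E) p) ≫ p.proj :=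
      (comp_evalUnit_hom _ _).symm.trans (triSnd_at a t ha)
    refine ((comp_dirAt _ _ _ _ _).trans ((Hom.dirAt_congr _ rfl h₁ _).trans
      (leftHom_dirAt a _ hy))).trans (Eq.trans ?_ (id_dirAt _ _ _ _).symm)
    exact tri_hom_ext ((triMk_proj _ _ _ _ _).trans ha) (Subsingleton.elim _ _)
      (triMk_snd _ _ _ _ _)
  inv_hom_id := by
    refine Hom.ext_dirAt (evalUnit.inv_hom_id_app p.pos) (fun b y w w' => ?_)
    have h₁ := leftHom_dirAt (b ≫ evalUnit.inv.app p.pos) y ((Category.assoc _ _ _).trans w)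
    refine ((comp_dirAt _ _ _ _ _).trans ((Hom.dirAt_congr _ rfl h₁ _).trans
      (leftInv_dirAt b _ (triMk_proj _ _ _ _ _).symm))).trans
        (Eq.trans ?_ (id_dirAt _ _ _ _).symm)
    exact triMk_snd _ _ _ _ _

variable (p) in
/-- The right unitor, from left to right. -/
def rightHom : p.tri (unit E) ⟶ p where
  onPos := p.evalFst (⊤_ E)
  onDir := triMk (pullback.fst _ _) (pullback.snd _ _) (terminal.from _) pullback.condition
    (Subsingleton.elim _ _)
  onDir_proj := triMk_proj _ _ _ _ _

theorem rightHom_dirAt {B : E} (a : B ⟶ p.eval.obj (⊤_ E)) (x : B ⟶ p.dir)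
    (w : a ≫ p.evalFst (⊤_ E) = x ≫ p.proj) :
    Hom.dirAt (rightHom p) a x w = triMk (q := unit E) a x (terminal.from _) w
      (Subsingleton.elim _ _) :=
  comp_triMk_eq _ _ _ (pullback.lift_fst _ _ _) (pullback.lift_snd _ _ _) (Subsingleton.elim _ _)

variable (p) in
/-- The right unitor, from right to left. -/
def rightInv : p ⟶ p.tri (unit E) where
  onPos := p.evalMk (𝟙 _) (terminal.from _)
  onDir := pullback.snd _ _ ≫ triFst p (unit E)
  onDir_proj := by
    have h := triFst_at _ (pullback.snd (p.evalMk (𝟙 _) (terminal.from _)) (triProj p (unit E)))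
      pullback.condition
    exact h.symm.trans (by simp)

theorem rightInv_dirAt {B : E} (b : B ⟶ p.pos) (t : B ⟶ triDir p (unit E))
    (w : b ≫ p.evalMk (𝟙 _) (terminal.from _) = t ≫ triProj p (unit E)) :
    Hom.dirAt (rightInv p) b t w = t ≫ triFst p (unit E) :=
  pullback.lift_snd_assoc _ _ _ _

theorem eval_terminal_ext {B : E} {z z' : B ⟶ p.eval.obj (⊤_ E)}
    (h : z ≫ p.evalFst _ = z' ≫ p.evalFst _) : z = z' :=
  eval_hom_ext _ h (fun _ _ _ _ => Subsingleton.elim _ _)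

variable (p) in
/-- The right unitor. -/
def rightUnit : p.tri (unit E) ≅ p where
  hom := rightHom p
  inv := rightInv p
  hom_inv_id := by
    have e : p.evalFst (⊤_ E) ≫ p.evalMk (𝟙 _) (terminal.from _) = 𝟙 _ :=
      eval_terminal_ext (by simp)
    refine Hom.ext_dirAt e (fun a t w w' => ?_)
    have ha : a = t ≫ triProj p (unit E) := (Category.comp_id a).symm.trans w'
    have h₁ := rightInv_dirAt (a ≫ p.evalFst (⊤_ E)) t ((Category.assoc _ _ _).trans w)
    refine ((comp_dirAt _ _ _ _ _).trans ((Hom.dirAt_congr _ rfl h₁ _).trans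
      (rightHom_dirAt a _ (triFst_at a t ha)))).trans (Eq.trans ?_ (id_dirAt _ _ _ _).symm)
    exact tri_hom_ext ((triMk_proj _ _ _ _ _).trans ha) (triMk_fst _ _ _ _ _)
      (Subsingleton.elim _ _)
  inv_hom_id := by
    refine Hom.ext_dirAt (evalMk_fst _ _ _) (fun b x w w' => ?_)
    have h₁ := rightHom_dirAt (b ≫ p.evalMk (𝟙 _) (terminal.from _)) x
      ((Category.assoc _ _ _).trans w)
    have h₂ := rightInv_dirAt b _ (triMk_proj (q := unit E) (b ≫ p.evalMk (𝟙 _) (terminal.from _))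
      x (terminal.from _) ((Category.assoc _ _ _).trans w) (Subsingleton.elim _ _)).symm
    have h₃ := triMk_fst (q := unit E) (b ≫ p.evalMk (𝟙 _) (terminal.from _))
      x (terminal.from _) ((Category.assoc _ _ _).trans w) (Subsingleton.elim _ _)
    exact ((comp_dirAt _ _ _ _ _).trans ((Hom.dirAt_congr _ rfl h₁ _).trans h₂)).trans
        (h₃.trans (id_dirAt _ _ _ _).symm)

theorem evalMapApp_leftHom (A : E) :
    (unit E).evalCompHom p A ≫ evalMapApp (leftHom p) A = evalUnit.hom.app (p.eval.obj A) := by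
  have hpos : ((unit E).evalCompHom p A ≫ evalMapApp (leftHom p) A) ≫ p.evalFst A =
      (unit E).eval.map (p.evalFst A) ≫ evalUnit.hom.app p.pos := by
    rw [Category.assoc, evalMapApp_fst, evalCompHom_fst_assoc]
    rfl
  refine eval_hom_ext _ (hpos.trans (evalUnit.hom.naturality _)) (fun b y w w' => ?_)
  have hb : (b ≫ (unit E).evalCompHom p A) ≫ ((unit E).tri p).evalFst A =
      b ≫ (unit E).eval.map (p.evalFst A) := by
    rw [Category.assoc, evalCompHom_fst]
  have hw : (b ≫ (unit E).eval.map (p.evalFst A)) ≫ evalUnit.hom.app p.pos = y ≫ p.proj := by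
    rw [Category.assoc, ← hpos, ← Category.assoc]
    exact w
  have h₁ : Hom.dirAt (leftHom p) ((b ≫ (unit E).evalCompHom p A) ≫ ((unit E).tri p).evalFst A) y
      (by rw [hb]; exact hw) = triMk (b ≫ (unit E).eval.map (p.evalFst A)) (terminal.from _) y
      (Subsingleton.elim _ _) ((comp_evalUnit_hom _ _).trans hw) :=
    (Hom.dirAt_congr _ hb rfl _).trans (leftHom_dirAt _ y hw)
  have hp₁ := (triMk_proj (b ≫ (unit E).eval.map (p.evalFst A)) (terminal.from _) y
      (Subsingleton.elim _ _) ((comp_evalUnit_hom _ _).trans hw)).symm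
  have L := (evalAt_congr _ (Category.assoc _ _ _).symm rfl w).trans
    ((evalAt_evalMapApp _ _ _ _).trans
    ((evalAt_congr _ rfl h₁ _).trans (evalAt_evalCompHom b _ (by rw [← hp₁, hb]) hp₁)))
  refine L.trans ?_
  exact evalAt_congr _ (comp_evalUnit_hom _ _) (triMk_snd _ _ _ _ _) _

theorem evalMapApp_rightHom (A : E) :
    p.evalCompHom (unit E) A ≫ evalMapApp (rightHom p) A = p.eval.map (evalUnit.hom.app A) := by
  have hpos : (p.evalCompHom (unit E) A ≫ evalMapApp (rightHom p) A) ≫ p.evalFst A =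
      p.eval.map ((unit E).evalFst A) ≫ p.evalFst (⊤_ E) := by
    rw [Category.assoc, evalMapApp_fst, evalCompHom_fst_assoc]
    rfl
  refine eval_hom_ext _ (hpos.trans (by simp)) (fun b x w w' => ?_)
  have hb : (b ≫ p.evalCompHom (unit E) A) ≫ (p.tri (unit E)).evalFst A =
      b ≫ p.eval.map ((unit E).evalFst A) := by
    rw [Category.assoc, evalCompHom_fst]
  have hw : (b ≫ p.eval.map ((unit E).evalFst A)) ≫ p.evalFst (⊤_ E) = x ≫ p.proj := by
    rw [Category.assoc, ← hpos, ← Category.assoc]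
    exact w
  have h₁ : Hom.dirAt (rightHom p) ((b ≫ p.evalCompHom (unit E) A) ≫
      (p.tri (unit E)).evalFst A) x (by rw [hb]; exact hw) =
      triMk (q := unit E) (b ≫ p.eval.map ((unit E).evalFst A)) x (terminal.from _) hw
      (Subsingleton.elim _ _) :=
    (Hom.dirAt_congr _ hb rfl _).trans (rightHom_dirAt _ x hw)
  have hp₁ := (triMk_proj (q := unit E) (b ≫ p.eval.map ((unit E).evalFst A)) x (terminal.from _)
    hw (Subsingleton.elim _ _)).symm
  have L := (evalAt_congr _ (Category.assoc _ _ _).symm rfl w).trans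
    ((evalAt_evalMapApp _ _ _ _).trans
    ((evalAt_congr _ rfl h₁ _).trans (evalAt_evalCompHom b _ (by rw [← hp₁, hb]) hp₁)))
  refine L.trans (Eq.trans ?_ (evalAt_comp_eval_map _ _ _ _ _).symm)
  refine (comp_evalUnit_hom _ _).trans ?_
  exact congrArg (fun k => k ≫ evalUnit.hom.app A) (evalAt_congr _ rfl (triMk_fst _ _ _ _ _) _)

end

section

variable {p q r : PolyIn E}

theorem hom_ext_app {φ ψ : p ⟶ q} (h : ∀ A, evalMapApp φ A = evalMapApp ψ A) : φ = ψ :=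
  evalMap_injective (NatTrans.ext (funext h))

theorem evalMapApp_id (A : E) : evalMapApp (𝟙 p) A = 𝟙 _ :=
  congrArg (fun k => k.app A) (evalMap_id p)

theorem evalMapApp_comp (φ : p ⟶ q) (ψ : q ⟶ r) (A : E) :
    evalMapApp (φ ≫ ψ) A = evalMapApp φ A ≫ evalMapApp ψ A :=
  congrArg (fun k => k.app A) (evalMap_comp φ ψ)

theorem evalMapApp_triMap_eq {p' q' : PolyIn E} (φ : p ⟶ p') (ψ : q ⟶ q') (A : E) :
    evalMapApp (triMap φ ψ) A = p.evalCompInv q A ≫ evalMapApp φ (q.eval.obj A) ≫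
      p'.eval.map (evalMapApp ψ A) ≫ p'.evalCompHom q' A := by
  rw [← evalMapApp_triMap, evalCompInv_hom_assoc]

theorem evalMapApp_assoc_hom (A : E) :
    evalMapApp (assoc p q r).hom A = (p.tri q).evalCompInv r A ≫ p.evalCompInv q (r.eval.obj A) ≫
      p.eval.map (q.evalCompHom r A) ≫ p.evalCompHom (q.tri r) A := by
  rw [← evalMapApp_assocHom, evalCompInv_hom_assoc]
  rfl

theorem evalMapApp_leftUnit_hom (A : E) :
    evalMapApp (leftUnit p).hom A =
      (unit E).evalCompInv p A ≫ evalUnit.hom.app (p.eval.obj A) := by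
  rw [← evalMapApp_leftHom, evalCompInv_hom_assoc]
  rfl

theorem evalMapApp_rightUnit_hom (A : E) :
    evalMapApp (rightUnit p).hom A =
      p.evalCompInv (unit E) A ≫ p.eval.map (evalUnit.hom.app A) := by
  rw [← evalMapApp_rightHom, evalCompInv_hom_assoc]
  rfl

theorem map_evalCompHom_inv (s : PolyIn E) (A : E) :
    s.eval.map (p.evalCompHom q A) ≫ s.eval.map (p.evalCompInv q A) = 𝟙 _ := by
  rw [← Functor.map_comp, evalCompHom_inv, Functor.map_id]

theorem map_evalCompHom_inv_assoc (s : PolyIn E) (A : E) {Z : E}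
    (k : s.eval.obj (p.eval.obj (q.eval.obj A)) ⟶ Z) :
    s.eval.map (p.evalCompHom q A) ≫ s.eval.map (p.evalCompInv q A) ≫ k = k := by
  rw [← Category.assoc, map_evalCompHom_inv, Category.id_comp]

end

instance : MonoidalCategoryStruct (PolyIn E) where
  tensorObj := tri
  whiskerLeft p _ _ φ := triMap (𝟙 p) φ
  whiskerRight φ q := triMap φ (𝟙 q)
  tensorHom := triMap
  tensorUnit := unit E
  associator := assoc
  leftUnitor := leftUnit
  rightUnitor := rightUnit

theorem triMap_id (p q : PolyIn E) : triMap (𝟙 p) (𝟙 q) = 𝟙 (p.tri q) :=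
  hom_ext_app fun A => by simp [evalMapApp_triMap_eq, evalMapApp_id]

theorem triMap_comp {p p' p'' q q' q'' : PolyIn E} (φ : p ⟶ p') (ψ : q ⟶ q') (φ' : p' ⟶ p'')
    (ψ' : q' ⟶ q'') : triMap φ ψ ≫ triMap φ' ψ' = triMap (φ ≫ φ') (ψ ≫ ψ') :=
  hom_ext_app fun A => by
    simp [evalMapApp_triMap_eq, evalMapApp_comp, evalMapApp_naturality_assoc]

theorem assoc_naturality {p p' q q' r r' : PolyIn E} (φ : p ⟶ p') (ψ : q ⟶ q') (χ : r ⟶ r') :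
    triMap (triMap φ ψ) χ ≫ (assoc p' q' r').hom =
      (assoc p q r).hom ≫ triMap φ (triMap ψ χ) :=
  hom_ext_app fun A => by
    simp only [evalMapApp_triMap_eq, evalMapApp_comp, evalMapApp_assoc_hom, Category.assoc,
      evalCompHom_inv_assoc, evalCompInv_naturality_assoc, evalMapApp_naturality_assoc,
      Functor.map_comp, map_evalCompHom_inv_assoc]

theorem leftUnit_naturality {p q : PolyIn E} (φ : p ⟶ q) :
    triMap (𝟙 (unit E)) φ ≫ (leftUnit q).hom = (leftUnit p).hom ≫ φ :=
  hom_ext_app fun A => by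
    simp [evalMapApp_triMap_eq, evalMapApp_comp, evalMapApp_id, evalMapApp_leftUnit_hom]

theorem rightUnit_naturality {p q : PolyIn E} (φ : p ⟶ q) :
    triMap φ (𝟙 (unit E)) ≫ (rightUnit q).hom = (rightUnit p).hom ≫ φ :=
  hom_ext_app fun A => by
    simp [evalMapApp_triMap_eq, evalMapApp_comp, evalMapApp_id, evalMapApp_rightUnit_hom,
      evalMapApp_naturality]

theorem pentagon (p q r s : PolyIn E) :
    triMap (assoc p q r).hom (𝟙 s) ≫ (assoc p (q.tri r) s).hom ≫
      triMap (𝟙 p) (assoc q r s).hom = (assoc (p.tri q) r s).hom ≫ (assoc p q (r.tri s)).hom :=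
  hom_ext_app fun A => by
    simp only [evalMapApp_triMap_eq, evalMapApp_comp, evalMapApp_id, evalMapApp_assoc_hom,
      Category.assoc, Functor.map_id, Category.id_comp, evalCompHom_inv_assoc, Functor.map_comp,
      evalCompInv_naturality_assoc, map_evalCompHom_inv_assoc]

theorem triangle (p q : PolyIn E) :
    (assoc p (unit E) q).hom ≫ triMap (𝟙 p) (leftUnit q).hom = triMap (rightUnit p).hom (𝟙 q) :=
  hom_ext_app fun A => by
    simp only [evalMapApp_triMap_eq, evalMapApp_comp, evalMapApp_id, evalMapApp_assoc_hom,
      evalMapApp_leftUnit_hom, evalMapApp_rightUnit_hom,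
      Category.assoc, Functor.map_id, Category.id_comp, evalCompHom_inv_assoc, Functor.map_comp,
      map_evalCompHom_inv_assoc]

/-- The monoidal category of polynomials, with the composition product. -/
instance : MonoidalCategory (PolyIn E) :=
  MonoidalCategory.ofTensorHom triMap_id (fun _ _ _ _ => rfl) (fun _ _ => rfl) triMap_comp
    assoc_naturality leftUnit_naturality rightUnit_naturality pentagon triangle

end PolyIn

open MonoidalCategory

section
open scoped ComonObj

/-- A bicomodule over comonoids `c` and `d` in a monoidal category: an object with a left
coaction of `c` and a right coaction of `d`, each counital and coassociative, which commute. -/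
structure Bicomodule {C : Type u} [Category.{v} C] [MonoidalCategory C] (c d : Comon C) where
  /-- the underlying object -/
  X : C
  /-- the left coaction -/
  left : X ⟶ c.X ⊗ X
  /-- the right coaction -/
  right : X ⟶ X ⊗ d.X
  left_counit : left ≫ ε[c.X] ▷ X = (λ_ X).inv
  left_coassoc : left ≫ c.X ◁ left = left ≫ Δ[c.X] ▷ X ≫ (α_ c.X c.X X).hom
  right_counit : right ≫ X ◁ ε[d.X] = (ρ_ X).inv
  right_coassoc : right ≫ X ◁ Δ[d.X] = right ≫ right ▷ d.X ≫ (α_ X d.X d.X).hom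
  compat : left ≫ c.X ◁ right = right ≫ left ▷ d.X ≫ (α_ c.X X d.X).hom

end

namespace PolyIn

variable [HasFiniteLimits E]

/-- The comultiplication of the comonad of a comonoid in polynomials. -/
def comonadComul (c : Comon (PolyIn E)) : c.X.eval ⟶ c.X.eval ⋙ c.X.eval :=
  evalMap ComonObj.comul ≫ (evalComp c.X c.X).inv

/-- The counit of the comonad of a comonoid in polynomials. -/
def comonadCounit (c : Comon (PolyIn E)) : c.X.eval ⟶ 𝟭 E :=
  evalMap ComonObj.counit ≫ evalUnit.hom

theorem comonad_coassoc (c : Comon (PolyIn E)) (A : E) :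
    (comonadComul c).app A ≫ c.X.eval.map ((comonadComul c).app A) =
      (comonadComul c).app A ≫ (comonadComul c).app (c.X.eval.obj A) := by
  let δ : c.X ⟶ c.X.tri c.X := ComonObj.comul
  have h₁ : δ ≫ triMap (𝟙 c.X) δ = δ ≫ triMap δ (𝟙 c.X) ≫ (assoc c.X c.X c.X).hom :=
    ComonObj.comul_assoc c.X
  have h₂ := congrArg (fun φ => evalMapApp φ A ≫ c.X.evalCompInv (c.X.tri c.X) A ≫
    c.X.eval.map (c.X.evalCompInv c.X A)) h₁
  simp only [evalMapApp_comp, evalMapApp_triMap_eq, evalMapApp_id, evalMapApp_assoc_hom,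
    Category.assoc, Category.id_comp, Functor.map_id, evalCompHom_inv_assoc,
    map_evalCompHom_inv, Category.comp_id] at h₂
  change (evalMapApp δ A ≫ c.X.evalCompInv c.X A) ≫
    c.X.eval.map (evalMapApp δ A ≫ c.X.evalCompInv c.X A) =
    (evalMapApp δ A ≫ c.X.evalCompInv c.X A) ≫ evalMapApp δ (c.X.eval.obj A) ≫
      c.X.evalCompInv c.X (c.X.eval.obj A)
  simpa only [Category.assoc, Functor.map_comp] using h₂

theorem comonad_left_counit (c : Comon (PolyIn E)) (A : E) :
    (comonadComul c).app A ≫ (comonadCounit c).app (c.X.eval.obj A) = 𝟙 (c.X.eval.obj A) := by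
  let δ : c.X ⟶ c.X.tri c.X := ComonObj.comul
  let ε : c.X ⟶ unit E := ComonObj.counit
  have h₁ : (δ ≫ triMap ε (𝟙 c.X)) ≫ (leftUnit c.X).hom = 𝟙 c.X :=
    (Iso.comp_hom_eq_id _).2 (ComonObj.counit_comul c.X)
  have h₂ := congrArg (fun φ => evalMapApp φ A) h₁
  simp only [evalMapApp_comp, evalMapApp_triMap_eq, evalMapApp_id, evalMapApp_leftUnit_hom,
    Category.assoc, Category.id_comp, Functor.map_id, evalCompHom_inv_assoc] at h₂
  change (evalMapApp δ A ≫ c.X.evalCompInv c.X A) ≫ evalMapApp ε (c.X.eval.obj A) ≫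
    evalUnit.hom.app (c.X.eval.obj A) = _
  simpa only [Category.assoc] using h₂

theorem comonad_right_counit (c : Comon (PolyIn E)) (A : E) :
    (comonadComul c).app A ≫ c.X.eval.map ((comonadCounit c).app A) = 𝟙 (c.X.eval.obj A) := by
  let δ : c.X ⟶ c.X.tri c.X := ComonObj.comul
  let ε : c.X ⟶ unit E := ComonObj.counit
  have h₁ : (δ ≫ triMap (𝟙 c.X) ε) ≫ (rightUnit c.X).hom = 𝟙 c.X :=
    (Iso.comp_hom_eq_id _).2 (ComonObj.comul_counit c.X)
  have h₂ := congrArg (fun φ => evalMapApp φ A) h₁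
  simp only [evalMapApp_comp, evalMapApp_triMap_eq, evalMapApp_id, evalMapApp_rightUnit_hom,
    Category.assoc, Category.id_comp, evalCompHom_inv_assoc] at h₂
  change (evalMapApp δ A ≫ c.X.evalCompInv c.X A) ≫ c.X.eval.map (evalMapApp ε A ≫
    evalUnit.hom.app A) = _
  simpa only [Category.assoc, Functor.map_comp] using h₂

/-- The comonad on `E` of a comonoid in polynomials. -/
def comonad (c : Comon (PolyIn E)) : Comonad E where
  toFunctor := c.X.eval
  ε := comonadCounit c
  δ := comonadComul c
  coassoc := comonad_coassoc c
  left_counit := comonad_left_counit c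
  right_counit := comonad_right_counit c

/-- The category of coalgebras of a comonoid `c` in polynomials: objects `S` with a coaction
`S ⟶ c.X.eval.obj S` that is counital and coassociative. -/
abbrev Coalg (c : Comon (PolyIn E)) : Type (max u v) := (comonad c).Coalgebra

variable {c d : Comon (PolyIn E)} (m : Bicomodule c d)

/-- The natural transformation `P(m) ⟶ P(c) ∘ P(m)` induced by the left coaction. -/
def evalLeft : m.X.eval ⟶ m.X.eval ⋙ c.X.eval :=
  evalMap m.left ≫ (evalComp c.X m.X).inv

/-- The natural transformation `P(m) ⟶ P(m) ∘ P(d)` induced by the right coaction. -/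
def evalRight : m.X.eval ⟶ d.X.eval ⋙ m.X.eval :=
  evalMap m.right ≫ (evalComp m.X d.X).inv

end PolyIn
end CategoryTheory

end

/-!
The polynomial functor of `m` is a right adjoint `R : E ⥤ Over m.X.pos` followed by the forgetful
functor, which preserves connected limits. By its counit law the right coaction
`P(m) ⟶ P(m) ∘ P(d)` respects the maps to the positions, so it lifts to `R`. If `L ⊣ R`, the mate
of the lifted coaction makes every `L T` a `d`-coalgebra, and coalgebra morphisms `L T ⟶ S`
correspond to maps `T ⟶ R S` equalizing the coaction and the structure map of `S`. Hence the
equalizer, taken in `Over m.X.pos`, is a right adjoint, and the forgetful functor, which preserves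
it, turns it into a functor that preserves connected limits. Finally `P(c)` preserves connected
limits too, so the left coaction restricts to the equalizers and connected limits of `c`-coalgebras
are computed in `E`.
-/

noncomputable section

/-- A coaction of a comonad `C` on the values of a functor `G`: a natural choice of a
`C`-coalgebra structure on every `G.obj S`. -/
structure LeftCoaction {B E : Type*} [Category* B] [Category* E] (C : Comonad E) (G : B ⥤ E) where
  hom : G ⟶ G ⋙ C.toFunctor
  counit (S : B) : hom.app S ≫ C.ε.app (G.obj S) = 𝟙 (G.obj S)
  coassoc (S : B) : hom.app S ≫ C.δ.app (G.obj S) = hom.app S ≫ C.map (hom.app S)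

namespace LeftCoaction

variable {B B' E : Type*} [Category* B] [Category* B'] [Category* E] {C : Comonad E}

/-- The coaction on the values of `K ⋙ G` given by a coaction on the values of `G`. -/
def whiskerLeft {G : B ⥤ E} (l : LeftCoaction C G) (K : B' ⥤ B) : LeftCoaction C (K ⋙ G) where
  hom := K.whiskerLeft l.hom
  counit S := l.counit (K.obj S)
  coassoc S := l.coassoc (K.obj S)

/-- The coaction on the values of a subfunctor `i : G ⟶ G'` that is carried into itself by a
coaction on the values of `G'`. -/
def restrict {G G' : B ⥤ E} (l : LeftCoaction C G') (i : G ⟶ G') [∀ S, Mono (i.app S)]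
    [∀ S, Mono (C.map (C.map (i.app S)))] (h : G ⟶ G ⋙ C.toFunctor)
    (w : h ≫ Functor.whiskerRight i C.toFunctor = i ≫ l.hom) : LeftCoaction C G where
  hom := h
  counit S := by
    have w_app : h.app S ≫ C.map (i.app S) = i.app S ≫ l.hom.app S := NatTrans.congr_app w S
    have ε_nat : C.map (i.app S) ≫ C.ε.app (G'.obj S) = C.ε.app (G.obj S) ≫ i.app S :=
      C.ε.naturality (i.app S)
    rw [← cancel_mono (i.app S), Category.assoc, ← ε_nat, reassoc_of% w_app, l.counit,
      Category.comp_id, Category.id_comp]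
  coassoc S := by
    have w_app : h.app S ≫ C.map (i.app S) = i.app S ≫ l.hom.app S := NatTrans.congr_app w S
    have δ_nat : C.map (i.app S) ≫ C.δ.app (G'.obj S) =
        C.δ.app (G.obj S) ≫ C.map (C.map (i.app S)) :=
      C.δ.naturality (i.app S)
    rw [← cancel_mono (C.map (C.map (i.app S))), Category.assoc, ← δ_nat,
      reassoc_of% w_app, l.coassoc, Category.assoc, ← C.map_comp, w_app, C.map_comp,
      reassoc_of% w_app]

/-- The lift of `G` to `C`-coalgebras given by a coaction on its values. -/
def toCoalgebra {G : B ⥤ E} (l : LeftCoaction C G) : B ⥤ C.Coalgebra where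
  obj S := ⟨G.obj S, l.hom.app S, l.counit S, l.coassoc S⟩
  map f := ⟨G.map f, (l.hom.naturality f).symm⟩

theorem preservesLimitsOfShape_toCoalgebra {G : B ⥤ E} (l : LeftCoaction C G) (J : Type*)
    [Category* J] [PreservesLimitsOfShape J C.toFunctor] [PreservesLimitsOfShape J G] :
    PreservesLimitsOfShape J l.toCoalgebra :=
  have : PreservesLimitsOfShape J (l.toCoalgebra ⋙ C.forget) :=
    inferInstanceAs (PreservesLimitsOfShape J G)
  have := Comonad.forgetCreatesLimitsOfShape (T := C) (J := J)
  preservesLimitsOfShape_of_reflects_of_preserves l.toCoalgebra C.forget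

end LeftCoaction

/-- The structure maps of the coalgebras of a comonad, as a natural transformation. -/
def coalgebraStructure {A : Type*} [Category* A] (D : Comonad A) :
    D.forget ⟶ D.forget ⋙ D.toFunctor where
  app S := S.a
  naturality _ _ f := f.h.symm

/-- A coaction of a comonad `D` on a functor `R` out of its base category. -/
structure RightCoaction {A X : Type*} [Category* A] [Category* X] (D : Comonad A) (R : A ⥤ X) where
  hom : R ⟶ D.toFunctor ⋙ R
  counit (S : A) : hom.app S ≫ R.map (D.ε.app S) = 𝟙 (R.obj S)
  coassoc (S : A) : hom.app S ≫ R.map (D.δ.app S) = hom.app S ≫ hom.app (D.obj S)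

namespace RightCoaction

/-- The coaction on `R ⋙ U` given by a coaction on `R`. -/
def whiskerRight {A X Y : Type*} [Category* A] [Category* X] [Category* Y] {D : Comonad A}
    {R : A ⥤ X} (r : RightCoaction D R) (U : X ⥤ Y) : RightCoaction D (R ⋙ U) where
  hom := Functor.whiskerRight r.hom U
  counit S := (U.map_comp _ _).symm.trans <|
    (congrArg U.map (r.counit S)).trans (U.map_id _)
  coassoc S := (U.map_comp _ _).symm.trans <|
    (congrArg U.map (r.coassoc S)).trans (U.map_comp _ _)

section Cotensor

variable {A X : Type*} [Category* A] [Category* X] {D : Comonad A} {R : A ⥤ X}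
  (r : RightCoaction D R) [HasEqualizers X]

/-- The cotensor product of a functor with right `D`-coaction and a `D`-coalgebra `S`: the equalizer
of the coaction on `R.obj S` and of the image under `R` of the structure map of `S`. -/
def cotensor : D.Coalgebra ⥤ X :=
  equalizer (D.forget.whiskerLeft r.hom) (Functor.whiskerRight (coalgebraStructure D) R)

/-- The inclusion of the cotensor product with `S` into `R.obj S`. -/
def cotensorι : r.cotensor ⟶ D.forget ⋙ R :=
  equalizer.ι _ _

theorem cotensor_condition (S : D.Coalgebra) :
    r.cotensorι.app S ≫ r.hom.app S.A = r.cotensorι.app S ≫ R.map S.a :=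
  NatTrans.congr_app (equalizer.condition (D.forget.whiskerLeft r.hom)
    (Functor.whiskerRight (coalgebraStructure D) R)) S

/-- The universal property of the cotensor product with `S`. -/
def isLimitCotensor (S : D.Coalgebra) :
    IsLimit (Fork.ofι (r.cotensorι.app S) (r.cotensor_condition S)) :=
  isLimitForkMapOfIsLimit ((evaluation _ _).obj S) _ (equalizerIsEqualizer _ _)

instance (S : D.Coalgebra) : Mono (r.cotensorι.app S) :=
  mono_of_isLimit_fork (r.isLimitCotensor S)

theorem mono_map_cotensorι {Y : Type*} [Category* Y] (H : X ⥤ Y)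
    [PreservesLimitsOfShape WalkingParallelPair H] (S : D.Coalgebra) :
    Mono (H.map (r.cotensorι.app S)) :=
  mono_of_isLimit_fork (isLimitForkMapOfIsLimit H _ (r.isLimitCotensor S))

/-- Functors that preserve equalizers commute with cotensor products. -/
def cotensorWhiskerRightIso {Y : Type*} [Category* Y] [HasEqualizers Y] (U : X ⥤ Y)
    [PreservesLimitsOfShape WalkingParallelPair U] :
    r.cotensor ⋙ U ≅ (r.whiskerRight U).cotensor :=
  PreservesEqualizer.iso ((Functor.whiskeringRight D.Coalgebra X Y).obj U)
    (D.forget.whiskerLeft r.hom) (Functor.whiskerRight (coalgebraStructure D) R)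

end Cotensor

section Adjunction

variable {A X : Type*} [Category* A] [Category* X] {D : Comonad A} {L : X ⥤ A} {R : A ⥤ X}
  (r : RightCoaction D R) (adj : L ⊣ R)

/-- The mate of a right coaction on a right adjoint. -/
def mate (T : X) : L.obj T ⟶ D.obj (L.obj T) :=
  (adj.homEquiv T _).symm (adj.unit.app T ≫ r.hom.app (L.obj T))

theorem homEquiv_mate (T : X) :
    adj.homEquiv T _ (r.mate adj T) = adj.unit.app T ≫ r.hom.app (L.obj T) :=
  Equiv.apply_symm_apply _ _

theorem homEquiv_mate_comp_map {T : X} {S : A} (f : L.obj T ⟶ S) :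
    adj.homEquiv T _ (r.mate adj T ≫ D.map f) = adj.homEquiv T S f ≫ r.hom.app S := by
  rw [adj.homEquiv_naturality_right, homEquiv_mate, adj.homEquiv_unit, Category.assoc,
    Category.assoc]
  exact congrArg (adj.unit.app T ≫ ·) (r.hom.naturality f).symm

/-- The coalgebra structure given by the mate of a right coaction on a right adjoint. -/
def mateCoalgebra (T : X) : D.Coalgebra where
  A := L.obj T
  a := r.mate adj T
  counit := (adj.homEquiv T _).injective <| by
    rw [adj.homEquiv_naturality_right, homEquiv_mate, Category.assoc, r.counit]
    exact (Category.comp_id _).trans (adj.homEquiv_id _).symm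
  coassoc := (adj.homEquiv T _).injective <| by
    refine Eq.trans ?_ (r.homEquiv_mate_comp_map adj _).symm
    rw [adj.homEquiv_naturality_right, homEquiv_mate, Category.assoc, Category.assoc, r.coassoc]

theorem mate_comp_map_eq_iff {T : X} {S : D.Coalgebra} (f : L.obj T ⟶ S.A) :
    r.mate adj T ≫ D.map f = f ≫ S.a ↔
      adj.homEquiv T _ f ≫ r.hom.app S.A = adj.homEquiv T _ f ≫ R.map S.a := by
  rw [← homEquiv_mate_comp_map, ← adj.homEquiv_naturality_right, EmbeddingLike.apply_eq_iff_eq]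

variable [HasEqualizers X]

/-- The adjunction between `T ↦ mateCoalgebra T` and the cotensor product, on morphisms. -/
def cotensorHomEquiv (T : X) (S : D.Coalgebra) :
    (r.mateCoalgebra adj T ⟶ S) ≃ (T ⟶ r.cotensor.obj S) :=
  calc (r.mateCoalgebra adj T ⟶ S)
    _ ≃ {f : L.obj T ⟶ S.A // r.mate adj T ≫ D.map f = f ≫ S.a} :=
      ⟨fun g => ⟨g.f, g.h⟩, fun f => ⟨f.1, f.2⟩, fun _ => rfl, fun _ => rfl⟩
    _ ≃ {f : T ⟶ R.obj S.A // f ≫ r.hom.app S.A = f ≫ R.map S.a} :=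
      (adj.homEquiv T S.A).subtypeEquiv (r.mate_comp_map_eq_iff adj)
    _ ≃ (T ⟶ r.cotensor.obj S) := (Fork.IsLimit.homIso (r.isLimitCotensor S) T).symm

theorem cotensorHomEquiv_comp_cotensorι {T : X} {S : D.Coalgebra} (g : r.mateCoalgebra adj T ⟶ S) :
    r.cotensorHomEquiv adj T S g ≫ r.cotensorι.app S = adj.homEquiv T S.A g.f :=
  (Fork.IsLimit.lift' (r.isLimitCotensor S) _ _).2

theorem cotensorHomEquiv_naturality_right {T : X} {S S' : D.Coalgebra}
    (g : r.mateCoalgebra adj T ⟶ S) (f : S ⟶ S') :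
    r.cotensorHomEquiv adj T S' (g ≫ f) = r.cotensorHomEquiv adj T S g ≫ r.cotensor.map f := by
  let ι (S : D.Coalgebra) : r.cotensor.obj S ⟶ R.obj S.A := r.cotensorι.app S
  have ι_nat : r.cotensor.map f ≫ ι S' = ι S ≫ R.map f.f := r.cotensorι.naturality f
  have equiv_ι {S : D.Coalgebra} (g : r.mateCoalgebra adj T ⟶ S) :
      r.cotensorHomEquiv adj T S g ≫ ι S = adj.homEquiv T S.A g.f :=
    r.cotensorHomEquiv_comp_cotensorι adj g
  refine Fork.IsLimit.hom_ext (r.isLimitCotensor S') ?_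
  calc r.cotensorHomEquiv adj T S' (g ≫ f) ≫ ι S'
    _ = adj.homEquiv T S'.A (g.f ≫ f.f) := equiv_ι (g ≫ f)
    _ = adj.homEquiv T S.A g.f ≫ R.map f.f := adj.homEquiv_naturality_right _ _
    _ = (r.cotensorHomEquiv adj T S g ≫ r.cotensor.map f) ≫ ι S' := by
      rw [← equiv_ι, Category.assoc, Category.assoc, ι_nat]

theorem isRightAdjoint_cotensor [R.IsRightAdjoint] : r.cotensor.IsRightAdjoint :=
  let adj := Adjunction.ofIsRightAdjoint R
  (Adjunction.adjunctionOfEquivLeft (r.cotensorHomEquiv adj)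
    fun _ _ _ f g => r.cotensorHomEquiv_naturality_right adj g f).isRightAdjoint

end Adjunction

section Over

variable {A E : Type*} [Category* A] [Category* E] {D : Comonad A} {B : E} {R : A ⥤ Over B}

theorem hom_app_comp_hom (r : RightCoaction D (R ⋙ Over.forget B)) (S : A) :
    r.hom.app S ≫ (R.obj (D.obj S)).hom = (R.obj S).hom := by
  let ρ : (R.obj S).left ⟶ (R.obj (D.obj S)).left := r.hom.app S
  have counit : ρ ≫ (R.map (D.ε.app S)).left = 𝟙 (R.obj S).left := r.counit S
  calc ρ ≫ (R.obj (D.obj S)).hom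
    _ = ρ ≫ (R.map (D.ε.app S)).left ≫ (R.obj S).hom := by
      rw [← Over.w (R.map (D.ε.app S))]; rfl
    _ = (R.obj S).hom := by rw [reassoc_of% counit]

/-- A right coaction on the underlying objects of a functor to `Over B` respects the maps to `B`,
because of the counit. -/
def toOver (r : RightCoaction D (R ⋙ Over.forget B)) : RightCoaction D R where
  hom :=
    { app S := Over.homMk (r.hom.app S) (r.hom_app_comp_hom S)
      naturality _ _ f := Over.OverMorphism.ext (r.hom.naturality f) }
  counit S := Over.OverMorphism.ext (r.counit S)
  coassoc S := Over.OverMorphism.ext (r.coassoc S)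

theorem preservesLimitsOfShape_cotensor [HasEqualizers E] [R.IsRightAdjoint]
    (r : RightCoaction D (R ⋙ Over.forget B)) (J : Type*) [Category* J] [IsConnected J] :
    PreservesLimitsOfShape J r.cotensor :=
  have : HasEqualizers (Over B) := Over.hasLimitsOfShape_of_isConnected
  have := r.toOver.isRightAdjoint_cotensor
  preservesLimitsOfShape_of_natIso (r.toOver.cotensorWhiskerRightIso (Over.forget B))

end Over

end RightCoaction

/-- A functor whose values carry a coaction of `C` and which carries a right coaction of `D`,
the two coactions commuting with each other. -/
structure Bicoaction {A E : Type*} [Category* A] [Category* E] (C : Comonad E) (D : Comonad A)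
    (N : A ⥤ E) where
  left : LeftCoaction C N
  right : RightCoaction D N
  compat (S : A) : left.hom.app S ≫ C.map (right.hom.app S) =
    right.hom.app S ≫ left.hom.app (D.obj S)

namespace Bicoaction

variable {A E : Type*} [Category* A] [Category* E] {C : Comonad E} {D : Comonad A} {N : A ⥤ E}
  (b : Bicoaction C D N) [HasEqualizers E]

theorem cotensorι_left_condition :
    (b.right.cotensorι ≫ D.forget.whiskerLeft b.left.hom) ≫
        Functor.whiskerRight (D.forget.whiskerLeft b.right.hom) C.toFunctor =
      (b.right.cotensorι ≫ D.forget.whiskerLeft b.left.hom) ≫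
        Functor.whiskerRight (Functor.whiskerRight (coalgebraStructure D) N) C.toFunctor := by
  ext S
  let ι : b.right.cotensor.obj S ⟶ N.obj S.A := b.right.cotensorι.app S
  have condition : ι ≫ b.right.hom.app S.A = ι ≫ N.map S.a := b.right.cotensor_condition S
  have left_nat : N.map S.a ≫ b.left.hom.app (D.obj S.A) =
      b.left.hom.app S.A ≫ C.map (N.map S.a) := b.left.hom.naturality S.a
  calc (ι ≫ b.left.hom.app S.A) ≫ C.map (b.right.hom.app S.A)
    _ = ι ≫ b.right.hom.app S.A ≫ b.left.hom.app (D.obj S.A) := by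
      rw [Category.assoc, b.compat]
    _ = ι ≫ N.map S.a ≫ b.left.hom.app (D.obj S.A) := by
      rw [reassoc_of% condition]
    _ = (ι ≫ b.left.hom.app S.A) ≫ C.map (N.map S.a) := by
      rw [left_nat, Category.assoc]

variable [PreservesLimitsOfShape WalkingParallelPair C.toFunctor]

/-- The natural transformation underlying the left coaction on the cotensor product. It exists
because `C` preserves the equalizer that defines the cotensor product. -/
def cotensorLeftHom : b.right.cotensor ⟶ b.right.cotensor ⋙ C.toFunctor :=
  Fork.IsLimit.lift (isLimitForkMapOfIsLimit ((Functor.whiskeringRight _ _ _).obj C.toFunctor) _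
    (equalizerIsEqualizer _ _)) _ b.cotensorι_left_condition

theorem cotensorLeftHom_comp_map_cotensorι :
    b.cotensorLeftHom ≫ Functor.whiskerRight b.right.cotensorι C.toFunctor =
      b.right.cotensorι ≫ D.forget.whiskerLeft b.left.hom :=
  Fork.IsLimit.lift_ι' _ _ _

/-- The left coaction on the cotensor product. -/
def cotensorLeft : LeftCoaction C b.right.cotensor :=
  have (S : D.Coalgebra) : Mono (C.map (C.map (b.right.cotensorι.app S))) :=
    b.right.mono_map_cotensorι (C.toFunctor ⋙ C.toFunctor) S
  (b.left.whiskerLeft D.forget).restrict b.right.cotensorι b.cotensorLeftHom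
    b.cotensorLeftHom_comp_map_cotensorι

/-- The cotensor product as a functor to `C`-coalgebras. -/
def coalgebraFunctor : D.Coalgebra ⥤ C.Coalgebra :=
  b.cotensorLeft.toCoalgebra

theorem coalgebraFunctor_a_comp_map_cotensorι (S : D.Coalgebra) :
    (b.coalgebraFunctor.obj S).a ≫ C.map (b.right.cotensorι.app S) =
      b.right.cotensorι.app S ≫ b.left.hom.app S.A :=
  NatTrans.congr_app b.cotensorLeftHom_comp_map_cotensorι S

theorem preservesLimitsOfShape_coalgebraFunctor (J : Type*) [Category* J]
    [PreservesLimitsOfShape J C.toFunctor] [PreservesLimitsOfShape J b.right.cotensor] :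
    PreservesLimitsOfShape J b.coalgebraFunctor :=
  b.cotensorLeft.preservesLimitsOfShape_toCoalgebra J

end Bicoaction

namespace CategoryTheory.PolyIn

variable {E : Type u} [Category.{v} E] [HasFiniteLimits E]

section ConnectedLimits

variable (p : PolyIn E)

/-- The polynomial functor of `p` before forgetting the map to the positions. -/
def evalOver : E ⥤ Over p.pos :=
  Over.star p.dir ⋙ (Over.pullback p.proj).rightAdjoint

instance : p.evalOver.IsRightAdjoint := p.evalAdj.isRightAdjoint

variable (J : Type*) [Category* J] [IsConnected J]

instance preservesLimitsOfShape_eval : PreservesLimitsOfShape J p.eval :=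
  inferInstanceAs (PreservesLimitsOfShape J (p.evalOver ⋙ Over.forget p.pos))

instance preservesLimitsOfShape_comonad (c : Comon (PolyIn E)) :
    PreservesLimitsOfShape J (comonad c).toFunctor :=
  c.X.preservesLimitsOfShape_eval J

theorem preservesLimitsOfShape_cotensor {D : Comonad E} (r : RightCoaction D p.eval) :
    PreservesLimitsOfShape J r.cotensor :=
  RightCoaction.preservesLimitsOfShape_cotensor (R := p.evalOver) r J

end ConnectedLimits

section EvalSplit

/-- The natural transformation `P(p) ⟶ P(q) ∘ P(r)` induced by a morphism `p ⟶ q ◁ r`. -/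
def evalSplit {p q r : PolyIn E} (φ : p ⟶ q.tri r) : p.eval ⟶ r.eval ⋙ q.eval :=
  evalMap φ ≫ (evalComp q r).inv

theorem evalSplit_app {p q r : PolyIn E} (φ : p ⟶ q.tri r) (A : E) :
    (evalSplit φ).app A = evalMapApp φ A ≫ q.evalCompInv r A :=
  rfl

variable {p q r s t t' : PolyIn E}

theorem evalSplit_comp_map_evalSplit {φ : p ⟶ q.tri t} {α : t ⟶ r.tri s} {ψ : p ⟶ t'.tri s}
    {β : t' ⟶ q.tri r}
    (h : φ ≫ triMap (𝟙 q) α = ψ ≫ triMap β (𝟙 s) ≫ (assoc q r s).hom) (A : E) :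
    (evalSplit φ).app A ≫ q.eval.map ((evalSplit α).app A) =
      (evalSplit ψ).app A ≫ (evalSplit β).app (s.eval.obj A) := by
  have h_app := congrArg (fun k => evalMapApp k A ≫ q.evalCompInv (r.tri s) A ≫
    q.eval.map (r.evalCompInv s A)) h
  simp only [evalMapApp_comp, evalMapApp_triMap_eq, evalMapApp_id, evalMapApp_assoc_hom,
    Category.assoc, Category.id_comp, Functor.map_id, evalCompHom_inv_assoc,
    map_evalCompHom_inv, Category.comp_id] at h_app
  simpa only [evalSplit_app, Category.assoc, Functor.map_comp] using h_app

theorem evalSplit_comp_counit {φ : p ⟶ q.tri p} {ε : q ⟶ unit E}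
    (h : φ ≫ triMap ε (𝟙 p) = (leftUnit p).inv) (A : E) :
    (evalSplit φ).app A ≫ evalMapApp ε (p.eval.obj A) ≫ evalUnit.hom.app (p.eval.obj A) =
      𝟙 (p.eval.obj A) := by
  have h_app := congrArg (evalMapApp · A) ((Iso.comp_hom_eq_id (leftUnit p)).2 h)
  simp only [evalMapApp_comp, evalMapApp_triMap_eq, evalMapApp_id, evalMapApp_leftUnit_hom,
    Category.assoc, Category.id_comp, Functor.map_id, evalCompHom_inv_assoc] at h_app
  simpa only [evalSplit_app, Category.assoc] using h_app

theorem evalSplit_comp_map_counit {φ : p ⟶ p.tri q} {ε : q ⟶ unit E}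
    (h : φ ≫ triMap (𝟙 p) ε = (rightUnit p).inv) (A : E) :
    (evalSplit φ).app A ≫ p.eval.map (evalMapApp ε A ≫ evalUnit.hom.app A) =
      𝟙 (p.eval.obj A) := by
  have h_app := congrArg (evalMapApp · A) ((Iso.comp_hom_eq_id (rightUnit p)).2 h)
  simp only [evalMapApp_comp, evalMapApp_triMap_eq, evalMapApp_id, evalMapApp_rightUnit_hom,
    Category.assoc, Category.id_comp, evalCompHom_inv_assoc] at h_app
  simpa only [evalSplit_app, Category.assoc, Functor.map_comp] using h_app

end EvalSplit

variable {c d : Comon (PolyIn E)}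

/-- The coactions of the comonads of `c` and `d` on the polynomial functor of a
`(c, d)`-bicomodule. -/
def bicoaction (m : Bicomodule c d) : Bicoaction (comonad c) (comonad d) m.X.eval where
  left :=
    { hom := evalLeft m
      counit := evalSplit_comp_counit m.left_counit
      coassoc A := (evalSplit_comp_map_evalSplit m.left_coassoc A).symm }
  right :=
    { hom := evalRight m
      counit := evalSplit_comp_map_counit m.right_counit
      coassoc := evalSplit_comp_map_evalSplit m.right_coassoc }
  compat := evalSplit_comp_map_evalSplit m.compat

end CategoryTheory.PolyIn

end

theorem mainTheorem12 {E : Type u} [Category.{v} E] [HasFiniteLimits E]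
    (c d : Comon (PolyIn E)) (m : Bicomodule c d) :
    ∃ (F : PolyIn.Coalg d ⥤ PolyIn.Coalg c)
      (ι : F ⋙ (PolyIn.comonad c).forget ⟶ (PolyIn.comonad d).forget ⋙ m.X.eval),
      (∀ S : PolyIn.Coalg d,
        ∃ w : ι.app S ≫ (PolyIn.evalRight m).app S.A = ι.app S ≫ m.X.eval.map S.a,
          Nonempty (IsLimit (Fork.ofι (ι.app S) w))) ∧
      (∀ S : PolyIn.Coalg d,
        (F.obj S).a ≫ c.X.eval.map (ι.app S) = ι.app S ≫ (PolyIn.evalLeft m).app S.A) ∧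
      ∀ (J : Type w) [Category.{w'} J] [IsConnected J], PreservesLimitsOfShape J F := by
  let b := PolyIn.bicoaction m
  refine ⟨b.coalgebraFunctor, b.right.cotensorι,
    fun S => ⟨b.right.cotensor_condition S, ⟨b.right.isLimitCotensor S⟩⟩,
    b.coalgebraFunctor_a_comp_map_cotensorι, fun J _ _ => ?_⟩
  have := m.X.preservesLimitsOfShape_cotensor J b.right
  exact b.preservesLimitsOfShape_coalgebraFunctor J
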